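/- Let $\mathcal A$ be a weakly idempotent complete exact category (that is, an additive category with a Quillen exact structure in which every split epimorphism is a deflation), let $\mathcal X$ and $\mathcal Y$ be full additive subcategories of $\mathcal A$ closed under isomorphisms and direct summands, and put $\omega=\mathcal X\cap\mathcal Y$. Define three classes of morphisms of $\mathcal A$ as follows. - $\mathrm{CoFib}^{\omega}$ is the class of $\omega$-monic morphisms, i.e. of the morphisms $f:A\to B$ such that $\mathrm{Hom}_{\mathcal A}(f,W):\mathrm{Hom}_{\mathcal A}(B,W)\to\mathrm{Hom}_{\mathcal A}(A,W)$ is surjective for every $W\in\omega$. - $\mathrm{Fib}^{\omega}$ is the class of deflations $f$ with $\operatorname{Ker} f\in\mathcal Y$. - $\mathrm{Weq}^{\omega}$ is the class of morphisms $f:A\to B$ for which there are $W\in\omega$ and $t:A\to W$ such that $\binom{f}{t}:A\to B\oplus W$ is an inflation with $\operatorname{Coker}\binom{f}{t}\in\mathcal X$. A model structure on $\mathcal A$ is a triple (cofibrations, fibrations, weak equivalences) of classes of morphisms that satisfies the two out of three axiom for weak equivalences, the retract axiom for each of the three classes, the lifting axiom (cofibrations lift against fibrations whenever one of the two is also a weak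 equivalence), and the factorization axiom (every morphism factors as a cofibration that is a weak equivalence followed by a fibration, and as a cofibration followed by a fibration that is a weak equivalence); $\mathcal A$ is not required to have finite limits or colimits. A cotorsion pair is a pair $(\mathcal X,\mathcal Y)$ with $\mathcal X=\{M \mid \mathrm{Ext}^1_{\mathcal A}(M,Y)=0\ \forall\, Y\in\mathcal Y\}$ and $\mathcal Y=\{N \mid \mathrm{Ext}^1_{\mathcal A}(X,N)=0\ \forall\, X\in\mathcal X\}$. It is complete if every object $M$ has admissible exact sequences $0\to Y\to X\to M\to 0$ and $0\to M\to Y'\to X'\to 0$ with $X,X'\in\mathcal X$ and $Y,Y'\in\mathcal Y$. It is hereditary if $\mathcal X$ is closed under kernels of deflations between objects of $\mathcal X$ and $\mathcal Y$ is closed under cokernels of inflations between objects of $\mathcal Y$. The class $\omega$ is covariantly finite in $\mathcal A$ if every object $M$ has a morphism $M\to W$ with $W\in\omega$ through which every morphism from $M$ to an object of $\omega$ factors. **Theorem.** The triple $(\mathrm{CoFib}^{\omega},\mathrm{Fib}^{\omega},\mathrm{Weq}^{\omega})$ is a model structure on $\mathcal A$ if and only if $(\mathcal X,\mathcal Y)$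 is a hereditary complete cotorsion pair in $\mathcal A$ and $\omega$ is covariantly finite in $\mathcal A$. If this is the case, then: 1. the class $\mathrm{CoFib}^{\omega}\cap\mathrm{Weq}^{\omega}$ of trivial cofibrations is precisely the class of inflations with cokernel in $\mathcal X$; 2. the class $\mathrm{Fib}^{\omega}\cap\mathrm{Weq}^{\omega}$ of trivial fibrations is precisely the class of split epimorphisms with kernel in $\omega$; 3. every object of $\mathcal A$ is cofibrant (i.e. $0\to M$ is a cofibration), the fibrant objects ($M\to 0$ is a fibration) are precisely the objects of $\mathcal Y$, and the trivial objects ($0\to M$ is a weak equivalence) are precisely the objects of $\mathcal X$; 4. the homotopy category $\mathrm{Ho}(\mathcal A)=\mathcal A[(\mathrm{Weq}^{\omega})^{-1}]$ is the additive quotient $\mathcal Y/\omega$, whose morphism groups are those of $\mathcal Y$ modulo the morphisms that factor through an object of $\omega$: the composite of the inclusion $\mathcal Y\hookrightarrow\mathcal A$ with the localization functor $\mathcal A\to\mathrm{Ho}(\mathcal A)$ induces an equivalence of categories $\mathcal Y/\omega\simeq\mathrm{Ho}(\mathcal A)$. -/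

import Mathlib

open CategoryTheory CategoryTheory.Limits
open scoped ZeroObject

universe v u

section ExactCategories

variable {A : Type u} [Category.{v} A] [Preadditive A] [HasZeroObject A] [HasBinaryBiproducts A]

variable (A) in
/-- A Quillen exact structure on the additive category `A` (Keller's axioms): a class of
kernel-cokernel pairs, the conflations, satisfying (E0), (E1), (E2) and (E2op). A morphism is a
deflation (an inflation) if it is the second (the first) component of some conflation. -/
structure ExactStructure where
  /-- the class of conflations -/
  conflation : ObjectProperty (ShortComplex A)
  /-- in a conflation the first morphism is a kernel of the second -/
  kernel_of_conflation (S : ShortComplex A) (hS : conflation S) :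
    Nonempty (IsLimit (KernelFork.ofι S.f S.zero))
  /-- in a conflation the second morphism is a cokernel of the first -/
  cokernel_of_conflation (S : ShortComplex A) (hS : conflation S) :
    Nonempty (IsColimit (CokernelCofork.ofπ S.g S.zero))
  /-- (E0), first half: conflations are closed under isomorphisms -/
  conflation_of_iso {S T : ShortComplex A} (e : S ≅ T) (hS : conflation S) : conflation T
  /-- (E0), second half: the identity of the zero object is a deflation -/
  id_zero_deflation : ∃ (K : A) (k : K ⟶ (0 : A)) (w : k ≫ 𝟙 (0 : A) = 0),
    conflation (ShortComplex.mk k (𝟙 (0 : A)) w)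
  /-- (E1): deflations are closed under composition -/
  deflation_comp {X Y Z : A} (d : X ⟶ Y) (d' : Y ⟶ Z)
    (hd : ∃ (K : A) (k : K ⟶ X) (w : k ≫ d = 0), conflation (ShortComplex.mk k d w))
    (hd' : ∃ (K : A) (k : K ⟶ Y) (w : k ≫ d' = 0), conflation (ShortComplex.mk k d' w)) :
    ∃ (K : A) (k : K ⟶ X) (w : k ≫ (d ≫ d') = 0), conflation (ShortComplex.mk k (d ≫ d') w)
  /-- (E2): deflations admit pullbacks along all morphisms, which are again deflations -/
  deflation_pullback {Y Z Z' : A} (d : Y ⟶ Z) (f : Z' ⟶ Z)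
    (hd : ∃ (K : A) (k : K ⟶ Y) (w : k ≫ d = 0), conflation (ShortComplex.mk k d w)) :
    ∃ (Y' : A) (f' : Y' ⟶ Y) (d' : Y' ⟶ Z'), IsPullback f' d' d f ∧
      ∃ (K : A) (k : K ⟶ Y') (w : k ≫ d' = 0), conflation (ShortComplex.mk k d' w)
  /-- (E2op): inflations admit pushouts along all morphisms, which are again inflations -/
  inflation_pushout {X Y X' : A} (i : X ⟶ Y) (f : X ⟶ X')
    (hi : ∃ (C : A) (c : Y ⟶ C) (w : i ≫ c = 0), conflation (ShortComplex.mk i c w)) :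
    ∃ (Y' : A) (f' : Y ⟶ Y') (i' : X' ⟶ Y'), IsPushout i f f' i' ∧
      ∃ (C : A) (c : Y' ⟶ C) (w : i' ≫ c = 0), conflation (ShortComplex.mk i' c w)

namespace ExactStructure

variable (E : ExactStructure A)

/-- `0 ⟶ X ⟶ Y ⟶ Z ⟶ 0`, with the morphisms `i` and `d`, is an admissible exact sequence. -/
def IsConflation {X Y Z : A} (i : X ⟶ Y) (d : Y ⟶ Z) : Prop :=
  ∃ w : i ≫ d = 0, E.conflation (ShortComplex.mk i d w)

/-- Deflations whose kernel lies in `P` (a class of objects closed under isomorphisms). -/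
def deflationWithKernelIn (P : ObjectProperty A) : MorphismProperty A :=
  fun X _ f => ∃ (K : A) (k : K ⟶ X), E.IsConflation k f ∧ P K

/-- Inflations whose cokernel lies in `P` (a class of objects closed under isomorphisms). -/
def inflationWithCokernelIn (P : ObjectProperty A) : MorphismProperty A :=
  fun _ Y f => ∃ (C : A) (c : Y ⟶ C), E.IsConflation f c ∧ P C

/-- Deflations. -/
def IsDeflation {X Y : A} (f : X ⟶ Y) : Prop :=
  ∃ (K : A) (k : K ⟶ X), E.IsConflation k f

/-- The exact category is weakly idempotent complete: every split epimorphism is a deflation. -/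
def IsWeaklyIdempotentComplete : Prop :=
  ∀ ⦃X Y : A⦄ (f : X ⟶ Y), IsSplitEpi f → E.IsDeflation f

/-- An extension of `X` by `Y`: an admissible exact sequence `0 ⟶ Y ⟶ M ⟶ X ⟶ 0`. -/
structure Extension (X Y : A) where
  /-- the middle term -/
  mid : A
  /-- the inflation -/
  inc : Y ⟶ mid
  /-- the deflation -/
  proj : mid ⟶ X
  isConflation : E.IsConflation inc proj

/-- Equivalence of extensions: an isomorphism of the middle terms that is the identity on both
ends. -/
def extensionSetoid (X Y : A) : Setoid (E.Extension X Y) where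
  r e e' := ∃ φ : e.mid ≅ e'.mid, e.inc ≫ φ.hom = e'.inc ∧ φ.hom ≫ e'.proj = e.proj
  iseqv :=
    { refl := fun e => ⟨Iso.refl _, by simp, by simp⟩
      symm := by
        rintro e e' ⟨φ, h₁, h₂⟩
        exact ⟨φ.symm, by simp [← h₁], by simp [← h₂]⟩
      trans := by
        rintro e e' e'' ⟨φ, h₁, h₂⟩ ⟨ψ, h₃, h₄⟩
        exact ⟨φ ≪≫ ψ, by simp [reassoc_of% h₁, h₃], by simp [h₄, h₂]⟩ }

/-- The (underlying set of the) Yoneda extension group `Ext¹(X, Y)`. -/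
def Ext1 (X Y : A) := _root_.Quotient (E.extensionSetoid X Y)

/-- `Ext¹(X, Y) = 0`. The class of the split extension is the neutral element, so the group
vanishes exactly when its underlying set has at most one element. -/
def Ext1Vanishes (X Y : A) : Prop := Subsingleton (E.Ext1 X Y)

/-- `(C, F)` is a cotorsion pair: `C` is the left and `F` the right `Ext¹`-orthogonal of the
other. -/
structure IsCotorsionPair (C F : ObjectProperty A) : Prop where
  left_iff (M : A) : C M ↔ ∀ N : A, F N → E.Ext1Vanishes M N
  right_iff (N : A) : F N ↔ ∀ M : A, C M → E.Ext1Vanishes M N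

/-- A complete cotorsion pair: every object `M` has admissible exact sequences
`0 ⟶ K ⟶ L ⟶ M ⟶ 0` and `0 ⟶ M ⟶ K' ⟶ L' ⟶ 0` with `L, L'` in `C` and `K, K'` in `F`. -/
structure IsCompleteCotorsionPair (C F : ObjectProperty A) : Prop
    extends E.IsCotorsionPair C F where
  exists_left (M : A) : ∃ (K L : A) (i : K ⟶ L) (d : L ⟶ M), E.IsConflation i d ∧ F K ∧ C L
  exists_right (M : A) : ∃ (K L : A) (i : M ⟶ K) (d : K ⟶ L), E.IsConflation i d ∧ F K ∧ C L

/-- A complete cotorsion pair that is hereditary: `C` is closed under kernels of deflations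
between its objects, and `F` under cokernels of inflations between its objects. -/
structure IsHereditaryCompleteCotorsionPair (C F : ObjectProperty A) : Prop
    extends E.IsCompleteCotorsionPair C F where
  kernel_mem {K L M : A} (i : K ⟶ L) (d : L ⟶ M) (_ : E.IsConflation i d) :
    C L → C M → C K
  cokernel_mem {K L M : A} (i : K ⟶ L) (d : L ⟶ M) (_ : E.IsConflation i d) :
    F K → F L → F M

end ExactStructure

/-- The full subcategory on `P` is an additive subcategory closed under isomorphisms and direct
summands. -/
structure IsAdditiveSubcategory (P : ObjectProperty A) : Prop where
  zero_mem : P (0 : A)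
  biprod_mem (M N : A) : P M → P N → P (M ⊞ N)
  iso_mem {M N : A} (e : M ≅ N) : P M → P N
  summand_mem (M N : A) (h : P (M ⊞ N)) : P M

/-- `P` is covariantly finite: every object has a left `P`-approximation. -/
def IsCovariantlyFinite (P : ObjectProperty A) : Prop :=
  ∀ M : A, ∃ (W : A) (f : M ⟶ W), P W ∧
    ∀ (W' : A) (g : M ⟶ W'), P W' → ∃ h : W ⟶ W', f ≫ h = g

/-- A (closed) model structure on a category, given by its three classes of morphisms. No finite
limits or colimits are assumed to exist. -/
structure IsModelStructure (cof fib weq : MorphismProperty A) : Prop where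
  two_out_of_three : weq.HasTwoOutOfThreeProperty
  cof_retract : cof.IsStableUnderRetracts
  fib_retract : fib.IsStableUnderRetracts
  weq_retract : weq.IsStableUnderRetracts
  lifting_left {M N P Q : A} (i : M ⟶ N) (p : P ⟶ Q) :
    cof i → weq i → fib p → HasLiftingProperty i p
  lifting_right {M N P Q : A} (i : M ⟶ N) (p : P ⟶ Q) :
    cof i → fib p → weq p → HasLiftingProperty i p
  factor_left {M N : A} (f : M ⟶ N) :
    ∃ (L : A) (i : M ⟶ L) (p : L ⟶ N), cof i ∧ weq i ∧ fib p ∧ i ≫ p = f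
  factor_right {M N : A} (f : M ⟶ N) :
    ∃ (L : A) (j : M ⟶ L) (q : L ⟶ N), cof j ∧ fib q ∧ weq q ∧ j ≫ q = f

/-- Cofibrant objects, for the class `cof` of cofibrations. -/
def cofibrantObjects (cof : MorphismProperty A) : ObjectProperty A :=
  fun M => cof (0 : (0 : A) ⟶ M)

/-- Fibrant objects, for the class `fib` of fibrations. -/
def fibrantObjects (fib : MorphismProperty A) : ObjectProperty A :=
  fun M => fib (0 : M ⟶ (0 : A))

/-- Trivial objects, for the class `weq` of weak equivalences. -/
def trivialObjects (weq : MorphismProperty A) : ObjectProperty A :=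
  fun M => weq (0 : (0 : A) ⟶ M)

/-- Split epimorphisms which have a kernel lying in `P`. -/
def splitEpiWithKernelIn (P : ObjectProperty A) : MorphismProperty A :=
  fun M _ f => IsSplitEpi f ∧
    ∃ (K : A) (k : K ⟶ M) (w : k ≫ f = 0), Nonempty (IsLimit (KernelFork.ofι k w)) ∧ P K

/-- The class of `ω`-monic morphisms. -/
def omegaMonic (ω : ObjectProperty A) : MorphismProperty A :=
  fun _ N f => ∀ W : A, ω W → Function.Surjective (fun h : N ⟶ W => f ≫ h)

/-- The morphisms `f : M ⟶ N` for which there is an inflation `(f, t)ᵀ : M ⟶ N ⊞ W` with `W` in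
`X ⊓ Y` and cokernel in `X`. -/
def omegaWeq (E : ExactStructure A) (X Y : ObjectProperty A) : MorphismProperty A :=
  fun M _ f => ∃ (W : A) (t : M ⟶ W), (X ⊓ Y) W ∧
    E.inflationWithCokernelIn X (biprod.lift f t)

/-- The relation on the morphisms of the full subcategory `Y` that identifies two morphisms if
their difference factors through an object in `ω`. -/
def factorsThroughRel (Y ω : ObjectProperty A) : HomRel Y.FullSubcategory :=
  fun M N f g => ∃ (W : A) (a : M.obj ⟶ W) (b : W ⟶ N.obj), ω W ∧ f.hom - g.hom = a ≫ b

/-- For an additive `ω` the relation is already a congruence, so that the morphisms in the quotient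
category below are the quotients `Hom(M, N) / Hom(M, ω, N)`. -/
theorem factorsThroughRel_congruence (Y : ObjectProperty A) {ω : ObjectProperty A}
    (hω : IsAdditiveSubcategory ω) : Congruence (factorsThroughRel Y ω) where
  equivalence :=
    { refl := fun _ => ⟨0, 0, 0, hω.zero_mem, by simp⟩
      symm := by
        rintro f g ⟨W, a, b, hW, h⟩
        exact ⟨W, -a, b, hW, by rw [Preadditive.neg_comp, ← h, neg_sub]⟩
      trans := by
        rintro f g k ⟨W, a, b, hW, h⟩ ⟨W', a', b', hW', h'⟩
        exact ⟨W ⊞ W', biprod.lift a a', biprod.desc b b', hω.biprod_mem _ _ hW hW', by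
          rw [biprod.lift_desc, ← h, ← h', sub_add_sub_cancel]⟩ }
  comp_left := by
    rintro _ _ _ f g g' ⟨W, a, b, hW, h⟩
    exact ⟨W, f.hom ≫ a, b, hW, by
      simp [← Preadditive.comp_sub, h]⟩
  comp_right := by
    rintro _ _ _ f f' g ⟨W, a, b, hW, h⟩
    exact ⟨W, a, b ≫ g.hom, hW, by
      simp [← Preadditive.sub_comp, h]⟩

/-- The additive quotient category `Y / ω`. -/
abbrev AdditiveQuotient (Y ω : ObjectProperty A) := CategoryTheory.Quotient (factorsThroughRel Y ω)

end ExactCategories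

/-! The key is a second description of the weak equivalences. For a hereditary complete cotorsion
pair, f : M → N lies in `omegaWeq` exactly when it induces bijections Hom(N, Z)/ω → Hom(M, Z)/ω for
all Z in Y (`omegaWeq_eq_localEquivalences`); two out of three and closure under retracts are then
formal. The hard inclusion is `omegaWeq_of_localEquivalences`: embed N in an object of Y, factor the
composite into an inflation and a deflation, show that the deflation splits, and pull back to N;
heredity puts the new cokernel in X.

An ω-monic weak equivalence is an inflation with cokernel in X, since its component into W can be
sheared away; a fibration that is a weak equivalence is a split epimorphism with kernel in ω. The
lifting axioms thus reduce to vanishing of Ext¹ (`Ext1Vanishes.exists_diagonal`) and to the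
definition of ω-monic. One factorization comes from completeness, the other is M → N ⊕ W → N with M
→ W a left ω-approximation.

Conversely, lifting 0 → C against fibrations kills Ext¹, factoring 0 → M and M → 0 gives
completeness and covariant finiteness, and two out of three closes X under kernels of deflations,
which implies the other half of heredity. For the homotopy category, fibrant replacement is
functorial modulo ω and inverts Y/ω → Ho(A). -/

section ExactCategories

variable {A : Type u} [Category.{v} A] [Preadditive A] [HasZeroObject A]

namespace ExactStructure

variable {E : ExactStructure A}

/-! ### Calculus of conflations. -/

section Conflations

variable {X Y Z : A} {i : X ⟶ Y} {d : Y ⟶ Z}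

namespace IsConflation

theorem zero (h : E.IsConflation i d) : i ≫ d = 0 := h.choose

theorem exists_lift (h : E.IsConflation i d) {T : A} (x : T ⟶ Y) (hx : x ≫ d = 0) :
    ∃ y : T ⟶ X, y ≫ i = x := by
  obtain ⟨w, hw⟩ := h
  obtain ⟨hl⟩ := E.kernel_of_conflation _ hw
  exact ⟨hl.lift (KernelFork.ofι x hx), hl.fac (KernelFork.ofι x hx) WalkingParallelPair.zero⟩

theorem exists_desc (h : E.IsConflation i d) {T : A} (x : Y ⟶ T) (hx : i ≫ x = 0) :
    ∃ y : Z ⟶ T, d ≫ y = x := by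
  obtain ⟨w, hw⟩ := h
  obtain ⟨hl⟩ := E.cokernel_of_conflation _ hw
  exact ⟨hl.desc (CokernelCofork.ofπ x hx),
    hl.fac (CokernelCofork.ofπ x hx) WalkingParallelPair.one⟩

theorem mono (h : E.IsConflation i d) : Mono i := by
  obtain ⟨w, hw⟩ := h
  obtain ⟨hl⟩ := E.kernel_of_conflation _ hw
  exact mono_of_isLimit_fork hl

theorem epi (h : E.IsConflation i d) : Epi d := by
  obtain ⟨w, hw⟩ := h
  obtain ⟨hl⟩ := E.cokernel_of_conflation _ hw
  exact epi_of_isColimit_cofork hl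

theorem isDeflation (h : E.IsConflation i d) : E.IsDeflation d := ⟨X, i, h⟩

theorem of_iso (h : E.IsConflation i d) {X' Y' Z' : A} {i' : X' ⟶ Y'} {d' : Y' ⟶ Z'}
    (e₁ : X ≅ X') (e₂ : Y ≅ Y') (e₃ : Z ≅ Z') (h₁ : i ≫ e₂.hom = e₁.hom ≫ i')
    (h₂ : d ≫ e₃.hom = e₂.hom ≫ d') : E.IsConflation i' d' := by
  have w : i' ≫ d' = 0 := by
    rw [← cancel_epi e₁.hom, ← reassoc_of% h₁, ← h₂, reassoc_of% h.zero]
    simp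
  obtain ⟨w', hw⟩ := h
  exact ⟨w, E.conflation_of_iso (ShortComplex.isoMk (S₂ := ShortComplex.mk i' d' w) e₁ e₂ e₃
    h₁.symm h₂.symm) hw⟩

/-- Any other kernel of the deflation of a conflation gives a conflation. -/
theorem of_isKernel (h : E.IsConflation i d) {K : A} {k : K ⟶ Y} [Mono k] (w : k ≫ d = 0)
    (hk : ∀ ⦃T : A⦄ (x : T ⟶ Y), x ≫ d = 0 → ∃ y : T ⟶ K, y ≫ k = x) :
    E.IsConflation k d := by
  have := h.mono
  obtain ⟨a, ha⟩ := hk i h.zero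
  obtain ⟨b, hb⟩ := h.exists_lift k w
  refine h.of_iso ⟨a, b, ?_, ?_⟩ (Iso.refl _) (Iso.refl _) (by simp [ha]) (by simp)
  · rw [← cancel_mono i, Category.assoc, hb, ha, Category.id_comp]
  · rw [← cancel_mono k, Category.assoc, ha, hb, Category.id_comp]

/-- Pulling back a conflation along a morphism. -/
theorem of_isPullback (h : E.IsConflation i d) {Y' Z' : A} {f' : Y' ⟶ Y} {d' : Y' ⟶ Z'}
    {f : Z' ⟶ Z} (sq : IsPullback f' d' d f) :
    ∃ i' : X ⟶ Y', E.IsConflation i' d' ∧ i' ≫ f' = i := by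
  have := h.mono
  obtain ⟨w, hw⟩ := id h
  obtain ⟨P, p, q, sq', K, k, wk, hk⟩ := E.deflation_pullback d f ⟨X, i, w, hw⟩
  have hd' : E.IsConflation (k ≫ (sq'.isoIsPullback _ _ sq).hom) d' :=
    IsConflation.of_iso (E := E) (i := k) (d := q) ⟨wk, hk⟩ (Iso.refl _)
      (sq'.isoIsPullback _ _ sq) (Iso.refl _) (by simp) (by simp)
  -- The morphism (i, 0) into the pullback is a kernel of d', so it may replace the kernel supplied
  -- by the axiom.
  have hz : i ≫ d = (0 : X ⟶ Z') ≫ f := by simp [w]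
  have hfst : sq.lift i 0 hz ≫ f' = i := sq.lift_fst _ _ _
  have : Mono (sq.lift i 0 hz) := by
    have : Mono (sq.lift i 0 hz ≫ f') := by rw [hfst]; infer_instance
    exact mono_of_mono _ f'
  refine ⟨sq.lift i 0 hz, hd'.of_isKernel (sq.lift_snd _ _ _) fun T x hx => ?_, hfst⟩
  obtain ⟨y, hy⟩ := h.exists_lift (x ≫ f') (by rw [Category.assoc, sq.w, reassoc_of% hx, zero_comp])
  exact ⟨y, sq.hom_ext (by simp [hy]) (by simp [hx])⟩

theorem exists_pullback (h : E.IsConflation i d) {Z' : A} (f : Z' ⟶ Z) :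
    ∃ (Y' : A) (f' : Y' ⟶ Y) (d' : Y' ⟶ Z') (i' : X ⟶ Y'), IsPullback f' d' d f ∧
      E.IsConflation i' d' ∧ i' ≫ f' = i := by
  obtain ⟨w, hw⟩ := id h
  obtain ⟨P, p, q, sq, -⟩ := E.deflation_pullback d f ⟨X, i, w, hw⟩
  obtain ⟨i', h₁, h₂⟩ := h.of_isPullback sq
  exact ⟨P, p, q, i', sq, h₁, h₂⟩

/-- Any other cokernel of the inflation of a conflation gives a conflation. -/
theorem of_isCokernel (h : E.IsConflation i d) {C : A} {c : Y ⟶ C} [Epi c] (w : i ≫ c = 0)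
    (hc : ∀ ⦃T : A⦄ (x : Y ⟶ T), i ≫ x = 0 → ∃ y : C ⟶ T, c ≫ y = x) :
    E.IsConflation i c := by
  have := h.epi
  obtain ⟨a, ha⟩ := hc d h.zero
  obtain ⟨b, hb⟩ := h.exists_desc c w
  refine h.of_iso (Iso.refl _) (Iso.refl _) ⟨b, a, ?_, ?_⟩ (by simp) (by simp [hb])
  · rw [← cancel_epi d, reassoc_of% hb, ha, Category.comp_id]
  · rw [← cancel_epi c, reassoc_of% ha, hb, Category.comp_id]

/-- Pushing out a conflation along a morphism. -/
theorem of_isPushout (h : E.IsConflation i d) {Y' X' : A} {f' : Y ⟶ Y'} {i' : X' ⟶ Y'}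
    {f : X ⟶ X'} (sq : IsPushout i f f' i') :
    ∃ d' : Y' ⟶ Z, E.IsConflation i' d' ∧ f' ≫ d' = d := by
  have := h.epi
  obtain ⟨w, hw⟩ := id h
  obtain ⟨P, p, q, sq', C, c, wc, hc⟩ := E.inflation_pushout i f ⟨Z, d, w, hw⟩
  have hi' : E.IsConflation i' ((sq'.isoIsPushout _ _ sq).inv ≫ c) :=
    IsConflation.of_iso (E := E) (i := q) (d := c) ⟨wc, hc⟩ (Iso.refl _)
      (sq'.isoIsPushout _ _ sq) (Iso.refl _) (by simp) (by simp)
  have hz : i ≫ d = f ≫ (0 : X' ⟶ Z) := by simp [w]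
  have hinl : f' ≫ sq.desc d 0 hz = d := sq.inl_desc _ _ _
  have : Epi (sq.desc d 0 hz) := by
    have : Epi (f' ≫ sq.desc d 0 hz) := by rw [hinl]; infer_instance
    exact epi_of_epi f' _
  refine ⟨sq.desc d 0 hz, hi'.of_isCokernel (sq.inr_desc _ _ _) fun T x hx => ?_, hinl⟩
  obtain ⟨y, hy⟩ := h.exists_desc (f' ≫ x) (by rw [reassoc_of% sq.w, hx, comp_zero])
  exact ⟨y, sq.hom_ext (by simp [hy]) (by simp [hx])⟩

theorem exists_pushout (h : E.IsConflation i d) {X' : A} (f : X ⟶ X') :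
    ∃ (Y' : A) (f' : Y ⟶ Y') (i' : X' ⟶ Y') (d' : Y' ⟶ Z), IsPushout i f f' i' ∧
      E.IsConflation i' d' ∧ f' ≫ d' = d := by
  obtain ⟨w, hw⟩ := id h
  obtain ⟨P, p, q, sq, -⟩ := E.inflation_pushout i f ⟨Z, d, w, hw⟩
  obtain ⟨d', h₁, h₂⟩ := h.of_isPushout sq
  exact ⟨P, p, q, d', sq, h₁, h₂⟩

/-- The deflation of a conflation splits as soon as the inflation does. -/
theorem exists_section (h : E.IsConflation i d) (r : Y ⟶ X) (hr : i ≫ r = 𝟙 X) :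
    ∃ s : Z ⟶ Y, s ≫ d = 𝟙 Z := by
  have := h.epi
  obtain ⟨s, hs⟩ := h.exists_desc (𝟙 Y - r ≫ i)
    (by rw [Preadditive.comp_sub, reassoc_of% hr, Category.comp_id, sub_self])
  refine ⟨s, ?_⟩
  rw [← cancel_epi d, reassoc_of% hs, Preadditive.sub_comp, Category.assoc, h.zero]
  simp

theorem exists_retraction (h : E.IsConflation i d) (s : Z ⟶ Y) (hs : s ≫ d = 𝟙 Z) :
    ∃ r : Y ⟶ X, i ≫ r = 𝟙 X ∧ r ≫ i = 𝟙 Y - d ≫ s := by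
  have := h.mono
  obtain ⟨r, hr⟩ := h.exists_lift (𝟙 Y - d ≫ s)
    (by rw [Preadditive.sub_comp, Category.assoc, hs, Category.id_comp, Category.comp_id, sub_self])
  refine ⟨r, ?_, hr⟩
  rw [← cancel_mono i, Category.assoc, hr, Preadditive.comp_sub, reassoc_of% h.zero]
  simp

/-- If the base change of a deflation `d` along an inflation with cokernel `c` is given,
the upper inflation of the square has cokernel `d ≫ c`. -/
theorem comp_of_isPullback (h : E.IsConflation i d) {K Q : A} {j : K ⟶ Z} {c : Z ⟶ Q}
    (hc : E.IsConflation j c) {L : A} {l : L ⟶ Y} {b : L ⟶ K} (sq : IsPullback l b d j) :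
    E.IsConflation l (d ≫ c) := by
  have := hc.mono
  obtain ⟨w₁, h₁⟩ := id h
  obtain ⟨w₂, h₂⟩ := id hc
  obtain ⟨R, r, wr, hr⟩ := E.deflation_comp d c ⟨_, i, w₁, h₁⟩ ⟨_, j, w₂, h₂⟩
  have hR : E.IsConflation r (d ≫ c) := ⟨wr, hr⟩
  have : Mono l := ⟨fun x y hxy => sq.hom_ext hxy (by
    rw [← cancel_mono j, Category.assoc, Category.assoc, ← sq.w, reassoc_of% hxy])⟩
  refine hR.of_isKernel (by rw [reassoc_of% sq.w, hc.zero, comp_zero]) fun T x hx => ?_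
  obtain ⟨y, hy⟩ := hc.exists_lift (x ≫ d) (by simpa using hx)
  exact ⟨sq.lift x y hy.symm, sq.lift_fst _ _ _⟩

end IsConflation

theorem IsDeflation.comp {d : X ⟶ Y} {d' : Y ⟶ Z} (h : E.IsDeflation d) (h' : E.IsDeflation d') :
    E.IsDeflation (d ≫ d') := by
  obtain ⟨K, k, hk⟩ := h
  obtain ⟨K', k', hk'⟩ := h'
  obtain ⟨L, l, b, -, sq, -, -⟩ := hk.exists_pullback k'
  exact ⟨L, l, hk.comp_of_isPullback hk' sq⟩

theorem IsDeflation.of_isPullback {Y' Z' : A} {d : Y ⟶ Z} {f' : Y' ⟶ Y} {d' : Y' ⟶ Z'}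
    {f : Z' ⟶ Z} (h : E.IsDeflation d) (sq : IsPullback f' d' d f) : E.IsDeflation d' := by
  obtain ⟨K, k, hk⟩ := h
  obtain ⟨k', hk', -⟩ := hk.of_isPullback sq
  exact ⟨K, k', hk'⟩

variable [HasBinaryBiproducts A]

/-- If `i` is an inflation, then so is every morphism with second component `i`. -/
theorem IsConflation.exists_lift_biprod (h : E.IsConflation i d) {X' : A} (f : X ⟶ X') :
    ∃ (C : A) (c : X' ⊞ Y ⟶ C), E.IsConflation (biprod.lift f i) c := by
  -- The fibre product P of Y and Y' over Z is X' ⊕ Y, because f' splits the projection P → Y. The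
  -- sign makes the kernel X → P of P → Y' become (f, i).
  obtain ⟨Y', f', i', d', sq, h', hd'⟩ := h.exists_pushout (-f)
  have := h'.mono
  obtain ⟨P, p, q, k, sq', hk, hkp⟩ := h.exists_pullback d'
  obtain ⟨a, ha⟩ := h'.exists_lift (q - p ≫ f') (by
    rw [Preadditive.sub_comp, Category.assoc, hd', sq'.w, sub_self])
  have hw : (biprod.snd : X' ⊞ Y ⟶ Y) ≫ d = biprod.desc i' f' ≫ d' := by
    ext <;> simp [h'.zero, hd']
  refine ⟨Y', biprod.desc i' f', hk.of_iso (Iso.refl _)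
    ⟨biprod.lift a p, sq'.lift biprod.snd (biprod.desc i' f') hw, ?_, ?_⟩ (Iso.refl _) ?_ ?_⟩
  · apply sq'.hom_ext
    · simp
    · simp [ha]
  · apply biprod.hom_ext
    · rw [← cancel_mono i']
      simp only [Category.assoc, biprod.lift_fst, ha, Preadditive.comp_sub, sq'.lift_snd,
        sq'.lift_fst_assoc, Category.id_comp]
      ext <;> simp
    · simp
  · have hka : k ≫ a = f := by
      rw [← cancel_mono i', Category.assoc, ha, Preadditive.comp_sub, hk.zero, reassoc_of% hkp,
        sq.w]
      simp
    apply biprod.hom_ext <;> simp [hka, hkp]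
  · rw [biprod.lift_desc, ha]
    simp

end Conflations

/-! ### Consequences of weak idempotent completeness. -/

section WeaklyIdempotentComplete

variable (hE : E.IsWeaklyIdempotentComplete)
include hE

theorem isConflation_of_section {K Y Z : A} {k : K ⟶ Y} {d : Y ⟶ Z} [Mono k] (w : k ≫ d = 0)
    (hk : ∀ ⦃T : A⦄ (x : T ⟶ Y), x ≫ d = 0 → ∃ y : T ⟶ K, y ≫ k = x)
    (s : Z ⟶ Y) (hs : s ≫ d = 𝟙 Z) : E.IsConflation k d := by
  obtain ⟨K', k', h⟩ := hE d ⟨⟨⟨s, hs⟩⟩⟩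
  exact h.of_isKernel w hk

theorem isConflation_id_zero (M : A) : E.IsConflation (𝟙 M) (0 : M ⟶ (0 : A)) :=
  isConflation_of_section hE (by simp) (fun T x _ => ⟨x, by simp⟩) 0
    ((isZero_zero A).eq_of_src _ _)

theorem isConflation_zero_id (M : A) : E.IsConflation (0 : (0 : A) ⟶ M) (𝟙 M) :=
  have : Mono (0 : (0 : A) ⟶ M) := ⟨fun _ _ _ => (isZero_zero A).eq_of_tgt _ _⟩
  isConflation_of_section hE (by simp) (fun T x hx => ⟨0, by simpa using hx.symm⟩) (𝟙 M) (by simp)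

variable [HasBinaryBiproducts A]

theorem isConflation_inl_snd (M N : A) :
    E.IsConflation (biprod.inl : M ⟶ M ⊞ N) (biprod.snd : M ⊞ N ⟶ N) :=
  isConflation_of_section hE (by simp) (fun T x hx => ⟨x ≫ biprod.fst, by
    ext <;> simp [hx]⟩) biprod.inr (by simp)

theorem isConflation_inr_fst (M N : A) :
    E.IsConflation (biprod.inr : N ⟶ M ⊞ N) (biprod.fst : M ⊞ N ⟶ M) :=
  isConflation_of_section hE (by simp) (fun T x hx => ⟨x ≫ biprod.snd, by
    ext <;> simp [hx]⟩) biprod.inl (by simp)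

/-- A class of objects closed under direct summands is closed under retracts. -/
theorem retract_mem {P : ObjectProperty A} (hP : IsAdditiveSubcategory P) {K W : A}
    (i : K ⟶ W) (r : W ⟶ K) (h : i ≫ r = 𝟙 K) (hW : P W) : P K := by
  obtain ⟨L, l, hl⟩ := hE r ⟨⟨⟨i, h⟩⟩⟩
  have := hl.mono
  obtain ⟨u, hu₁, hu₂⟩ := hl.exists_retraction i h
  have hu : i ≫ u = 0 := by
    rw [← cancel_mono l, Category.assoc, hu₂, Preadditive.comp_sub, reassoc_of% h]
    simp
  refine hP.summand_mem K L (hP.iso_mem ⟨biprod.lift r u, biprod.desc i l, ?_, ?_⟩ hW)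
  · rw [biprod.lift_desc, hu₂]
    simp
  · ext <;> simp [h, hl.zero, hu₁, hu]

/-- (d, f) is d ⊕ 1, a base change of d, followed by the split epimorphism (1, f). -/
theorem IsConflation.deflation_biprod_desc {K Y Z Z' : A} {k : K ⟶ Y} {d : Y ⟶ Z}
    (h : E.IsConflation k d) (f : Z' ⟶ Z) : E.IsDeflation (biprod.desc d f) := by
  have sq : IsPullback (biprod.fst : Y ⊞ Z' ⟶ Y) (biprod.map d (𝟙 Z')) d
      (biprod.fst : Z ⊞ Z' ⟶ Z) := by
    refine ⟨⟨by simp⟩, ⟨PullbackCone.IsLimit.mk _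
      (fun s => biprod.lift s.fst (s.snd ≫ biprod.snd)) (fun s => by simp) (fun s => ?_)
      (fun s m h₁ h₂ => ?_)⟩⟩
    · apply biprod.hom_ext
      · simpa using s.condition
      · simp
    · apply biprod.hom_ext
      · simpa using h₁
      · simp [← h₂]
  have h₁ : E.IsDeflation (biprod.map d (𝟙 Z')) := h.isDeflation.of_isPullback sq
  have h₂ : E.IsDeflation (biprod.desc (𝟙 Z) f) := hE _ ⟨⟨⟨biprod.inl, by simp⟩⟩⟩
  have := h₁.comp h₂
  rwa [show biprod.map d (𝟙 Z') ≫ biprod.desc (𝟙 Z) f = biprod.desc d f by ext <;> simp] at this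

/-- The kernel K of the composite contains M as a direct summand, with complement L. Pushing out K →
M ⊕ N along the projection K → L kills M and leaves a conflation L → N → Q. -/
theorem IsDeflation.of_snd_comp {M N Q : A} {g : N ⟶ Q}
    (h : E.IsDeflation ((biprod.snd : M ⊞ N ⟶ N) ≫ g)) : E.IsDeflation g := by
  obtain ⟨K, k, hk⟩ := h
  have := hk.mono
  obtain ⟨s, hs⟩ := hk.exists_lift biprod.inl (by simp)
  have hs' : s ≫ k ≫ biprod.fst = 𝟙 M := by rw [reassoc_of% hs]; simp
  obtain ⟨L, l, hl⟩ := hE (k ≫ biprod.fst) ⟨⟨⟨s, hs'⟩⟩⟩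
  have := hl.mono
  obtain ⟨r, hr₁, hr₂⟩ := hl.exists_retraction s hs'
  have hsr : s ≫ r = 0 := by
    rw [← cancel_mono l, Category.assoc, hr₂, Preadditive.comp_sub, Category.assoc, reassoc_of% hs']
    simp
  have hw : k ≫ biprod.snd = r ≫ l ≫ k ≫ biprod.snd := by
    rw [reassoc_of% hr₂, Preadditive.sub_comp, Category.assoc, Category.assoc, reassoc_of% hs]
    simp
  have key : ∀ {T : A} (a : M ⊞ N ⟶ T) (b : L ⟶ T), k ≫ a = r ≫ b → biprod.inl ≫ a = 0 := by
    intro T a b hab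
    rw [← hs, Category.assoc, hab, reassoc_of% hsr, zero_comp]
  have fac : ∀ {T : A} (a : M ⊞ N ⟶ T) (b : L ⟶ T), k ≫ a = r ≫ b →
      biprod.snd ≫ biprod.inr ≫ a = a := by
    intro T a b hab
    ext
    · simp [key a b hab]
    · simp
  have sq : IsPushout k r biprod.snd (l ≫ k ≫ biprod.snd) := by
    refine ⟨⟨hw⟩, ⟨PushoutCocone.IsColimit.mk _ (fun s => biprod.inr ≫ s.inl)
      (fun s => fac _ _ s.condition) (fun s => ?_) (fun s m h₁ h₂ => ?_)⟩⟩
    · rw [Category.assoc, Category.assoc, fac _ _ s.condition, s.condition, reassoc_of% hr₁]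
    · rw [← h₁]
      simp
  obtain ⟨g', hg', e⟩ := hk.of_isPushout sq
  rw [cancel_epi] at e
  exact ⟨L, _, e ▸ hg'⟩

/-- If a composition is a deflation, then so is its second factor. -/
theorem IsDeflation.of_comp {M N Q : A} {h : M ⟶ N} {g : N ⟶ Q} (hd : E.IsDeflation (h ≫ g)) :
    E.IsDeflation g := by
  obtain ⟨K, k, hk⟩ := hd
  have h₁ := hk.deflation_biprod_desc hE g
  -- Precomposed with this shear, the deflation (h ≫ g, g) becomes `biprod.snd ≫ g`.
  have h₂ : E.IsDeflation (biprod.lift (biprod.fst : M ⊞ N ⟶ M)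
      (biprod.snd - biprod.fst ≫ h)) :=
    hE _ ⟨⟨⟨biprod.lift biprod.fst (biprod.snd + biprod.fst ≫ h), by
      ext <;> simp⟩⟩⟩
  have h₃ := h₂.comp h₁
  apply IsDeflation.of_snd_comp hE (M := M)
  convert h₃ using 1
  ext <;> simp

/-- If `f ≫ biprod.inl` is an inflation, then `f` is an inflation, and its cokernel is a retract of
the given one. -/
theorem IsConflation.of_comp_inl {M N W D : A} {f : M ⟶ N} {d : N ⊞ W ⟶ D}
    (h : E.IsConflation (f ≫ biprod.inl) d) :
    ∃ (Q : A) (q : N ⟶ Q) (l : Q ⟶ D) (r : D ⟶ Q), E.IsConflation f q ∧ l ≫ r = 𝟙 Q := by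
  have := h.epi
  -- The projection to W vanishes on M, hence descends to D, where it is split by W → D. With Q its
  -- kernel, N is the pullback of Q → D along d.
  obtain ⟨p, hp⟩ := h.exists_desc biprod.snd (by simp)
  have hs : (biprod.inr ≫ d) ≫ p = 𝟙 W := by simp [hp]
  obtain ⟨Q, l, hl⟩ := hE p ⟨⟨⟨_, hs⟩⟩⟩
  have := hl.mono
  obtain ⟨r, hr, -⟩ := hl.exists_retraction _ hs
  obtain ⟨b, hb⟩ := hl.exists_lift (biprod.inl ≫ d) (by simp [hp])
  have fac : ∀ {T : A} (x : T ⟶ N ⊞ W) (y : T ⟶ Q), x ≫ d = y ≫ l →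
      (x ≫ biprod.fst) ≫ biprod.inl = x := by
    intro T x y hxy
    have : x ≫ biprod.snd = 0 := by rw [← hp, reassoc_of% hxy, hl.zero, comp_zero]
    ext <;> simp [this]
  have sq : IsPullback biprod.inl b d l := by
    refine ⟨⟨hb.symm⟩, ⟨PullbackCone.IsLimit.mk _ (fun s => s.fst ≫ biprod.fst)
      (fun s => fac _ _ s.condition) (fun s => ?_) (fun s m h₁ h₂ => ?_)⟩⟩
    · rw [← cancel_mono l, Category.assoc, hb, ← Category.assoc, fac _ _ s.condition, s.condition]
    · rw [← h₁]
      simp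
  obtain ⟨f', hf', e⟩ := h.of_isPullback sq
  rw [cancel_mono] at e
  exact ⟨Q, b, l, r, e ▸ hf', hr⟩

theorem Ext1Vanishes.exists_section {C K P : A} (h : E.Ext1Vanishes C K) {i : K ⟶ P} {d : P ⟶ C}
    (hc : E.IsConflation i d) : ∃ s : C ⟶ P, s ≫ d = 𝟙 C := by
  let e₁ : E.Extension C K := ⟨P, i, d, hc⟩
  let e₂ : E.Extension C K := ⟨K ⊞ C, biprod.inl, biprod.snd, isConflation_inl_snd hE K C⟩
  have h' := h
  unfold Ext1Vanishes Ext1 at h'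
  obtain ⟨φ, h₁, h₂⟩ := _root_.Quotient.exact (s := E.extensionSetoid C K)
    (Subsingleton.elim (_root_.Quotient.mk _ e₂) (_root_.Quotient.mk _ e₁))
  refine ⟨biprod.inr ≫ φ.hom, ?_⟩
  have h₂' : φ.hom ≫ d = biprod.snd := h₂
  rw [Category.assoc, h₂']
  simp

end WeaklyIdempotentComplete

variable [HasBinaryBiproducts A]

/-- `Ext¹` vanishes if all extensions split. -/
theorem ext1Vanishes_of_sections {C K : A}
    (h : ∀ (P : A) (i : K ⟶ P) (d : P ⟶ C), E.IsConflation i d → ∃ s : C ⟶ P, s ≫ d = 𝟙 C) :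
    E.Ext1Vanishes C K := by
  suffices key : ∀ e : E.Extension C K, ∃ φ : e.mid ≅ K ⊞ C,
      e.inc ≫ φ.hom = biprod.inl ∧ φ.hom ≫ biprod.snd = e.proj by
    refine ⟨fun a b => ?_⟩
    induction a using _root_.Quotient.inductionOn with | _ e
    induction b using _root_.Quotient.inductionOn with | _ e'
    obtain ⟨φ, h₁, h₂⟩ := key e
    obtain ⟨ψ, h₃, h₄⟩ := key e'
    exact _root_.Quotient.sound ⟨φ ≪≫ ψ.symm, by simp [reassoc_of% h₁, ← h₃], by simp [← h₂, ← h₄]⟩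
  intro e
  have he := e.isConflation
  have := he.mono
  obtain ⟨s, hs⟩ := h _ _ _ he
  obtain ⟨r, hr₁, hr₂⟩ := he.exists_retraction s hs
  have hsr : s ≫ r = 0 := by
    rw [← cancel_mono e.inc, Category.assoc, hr₂, Preadditive.comp_sub, reassoc_of% hs]
    simp
  refine ⟨⟨biprod.lift r e.proj, biprod.desc e.inc s, ?_, ?_⟩, ?_, ?_⟩
  · rw [biprod.lift_desc, hr₂]
    simp
  · ext <;> simp [hr₁, hs, hsr, he.zero]
  · ext <;> simp [hr₁, he.zero]
  · simp

/-! ### Extension and lifting properties from vanishing of Ext¹. -/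

section Orthogonality

variable (hE : E.IsWeaklyIdempotentComplete) {C K : A} (h : E.Ext1Vanishes C K)
include hE h

/-- Morphisms to `K` extend along inflations with cokernel `C` if `Ext¹(C, K) = 0`. -/
theorem Ext1Vanishes.exists_extension {M N : A} {i : M ⟶ N} {c : N ⟶ C} (hi : E.IsConflation i c)
    (a : M ⟶ K) : ∃ b : N ⟶ K, i ≫ b = a := by
  obtain ⟨P, a', i', d', sq, hc, -⟩ := hi.exists_pushout a
  obtain ⟨s, hs⟩ := h.exists_section hE hc
  obtain ⟨r, hr, -⟩ := hc.exists_retraction s hs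
  exact ⟨a' ≫ r, by rw [reassoc_of% sq.w, hr, Category.comp_id]⟩

/-- Morphisms from `C` lift along deflations with kernel `K` if `Ext¹(C, K) = 0`. -/
theorem Ext1Vanishes.exists_lifting {P Q : A} {k : K ⟶ P} {p : P ⟶ Q} (hp : E.IsConflation k p)
    (a : C ⟶ Q) : ∃ b : C ⟶ P, b ≫ p = a := by
  obtain ⟨P', a', p', k', sq, hc, -⟩ := hp.exists_pullback a
  obtain ⟨s, hs⟩ := h.exists_section hE hc
  exact ⟨s ≫ a', by rw [Category.assoc, sq.w, reassoc_of% hs]⟩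

/-- Inflations with cokernel `C` have the left lifting property with respect to deflations with
kernel `K` if `Ext¹(C, K) = 0`. -/
theorem Ext1Vanishes.exists_diagonal {M N P Q : A} {i : M ⟶ N} {c : N ⟶ C} {k : K ⟶ P} {p : P ⟶ Q}
    (hi : E.IsConflation i c) (hp : E.IsConflation k p) (f : M ⟶ P) (g : N ⟶ Q)
    (w : f ≫ p = i ≫ g) : ∃ b : N ⟶ P, i ≫ b = f ∧ b ≫ p = g := by
  -- After base change along g, a diagonal is a section of q : R → N that restricts to u : M → R.
  obtain ⟨R, g', q, k', sq, hq, hk'⟩ := hp.exists_pullback g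
  have := hq.mono
  have := hi.mono
  obtain ⟨u, hu₁, hu₂⟩ : ∃ u : M ⟶ R, u ≫ g' = f ∧ u ≫ q = i :=
    ⟨sq.lift f i w, sq.lift_fst _ _ _, sq.lift_snd _ _ _⟩
  obtain ⟨S, l, b, -, sq', -, -⟩ := hq.exists_pullback i
  have hl := hq.comp_of_isPullback hi sq'
  -- The preimage of M in R is K ⊕ M, and its inclusion has cokernel C. Extending the projection K ⊕
  -- M → K to R gives a retraction that kills u; the section complementary to it restricts to u.
  have hm : Mono (biprod.desc k' u) := by
    refine Preadditive.mono_of_cancel_zero _ fun {T} x hx => ?_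
    have h₁ : x ≫ biprod.snd = 0 := by
      rw [← cancel_mono i]
      have := hx =≫ q
      rw [biprod.desc_eq] at this
      simpa [hq.zero, hu₂] using this
    have h₂ : x ≫ biprod.fst = 0 := by
      rw [← cancel_mono k']
      rw [biprod.desc_eq] at hx
      simpa [reassoc_of% h₁] using hx
    ext <;> simp [h₁, h₂]
  have hl' : E.IsConflation (biprod.desc k' u) (q ≫ c) := by
    refine hl.of_isKernel ?_ fun T x hx => ?_
    · ext
      · simp [reassoc_of% hq.zero]
      · simp [reassoc_of% hu₂, hi.zero]
    · obtain ⟨m, hm⟩ := hi.exists_lift (x ≫ q) (by simpa using hx)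
      obtain ⟨n, hn⟩ := hq.exists_lift (x - m ≫ u) (by simp [hu₂, hm])
      exact ⟨biprod.lift n m, by simp [hn]⟩
  obtain ⟨r, hr⟩ := h.exists_extension hE hl' biprod.fst
  have hr₁ : k' ≫ r = 𝟙 K := by simpa using biprod.inl ≫= hr
  have hr₂ : u ≫ r = 0 := by simpa using biprod.inr ≫= hr
  obtain ⟨s, hs⟩ := hq.exists_desc (𝟙 R - r ≫ k')
    (by rw [Preadditive.comp_sub, reassoc_of% hr₁, Category.comp_id, sub_self])
  have hsq : s ≫ q = 𝟙 N := by
    have := hq.epi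
    rw [← cancel_epi q, reassoc_of% hs, Preadditive.sub_comp, Category.assoc, hq.zero]
    simp
  refine ⟨s ≫ g', ?_, by rw [Category.assoc, sq.w, reassoc_of% hsq]⟩
  rw [← hu₂, Category.assoc, reassoc_of% hs, Preadditive.sub_comp, Preadditive.comp_sub,
    Category.id_comp, hu₁, Category.assoc, reassoc_of% hr₂]
  simp

end Orthogonality

end ExactStructure

end ExactCategories

/-! ### Morphisms modulo ω and local equivalences. -/

section ExactCategories

variable {A : Type u} [Category.{v} A]

/-- The morphisms that factor through an object of `ω`. -/
def FactorsThrough (ω : ObjectProperty A) {M N : A} (f : M ⟶ N) : Prop :=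
  ∃ (W : A) (a : M ⟶ W) (b : W ⟶ N), ω W ∧ f = a ≫ b

namespace FactorsThrough

variable {ω : ObjectProperty A} {L M N : A}

theorem comp_left {g : M ⟶ N} (hg : FactorsThrough ω g) (f : L ⟶ M) :
    FactorsThrough ω (f ≫ g) := by
  obtain ⟨W, a, b, hW, rfl⟩ := hg
  exact ⟨W, f ≫ a, b, hW, by simp⟩

theorem comp_right {f : L ⟶ M} (hf : FactorsThrough ω f) (g : M ⟶ N) :
    FactorsThrough ω (f ≫ g) := by
  obtain ⟨W, a, b, hW, rfl⟩ := hf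
  exact ⟨W, a, b ≫ g, hW, by simp⟩

variable [Preadditive A]

theorem neg {f : M ⟶ N} (hf : FactorsThrough ω f) : FactorsThrough ω (-f) := by
  obtain ⟨W, a, b, hW, rfl⟩ := hf
  exact ⟨W, -a, b, hW, by simp⟩

variable [HasZeroObject A] [HasBinaryBiproducts A]

theorem add (hω : IsAdditiveSubcategory ω) {f g : M ⟶ N} (hf : FactorsThrough ω f)
    (hg : FactorsThrough ω g) : FactorsThrough ω (f + g) := by
  obtain ⟨W, a, b, hW, rfl⟩ := hf
  obtain ⟨W', a', b', hW', rfl⟩ := hg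
  exact ⟨W ⊞ W', biprod.lift a a', biprod.desc b b', hω.biprod_mem _ _ hW hW', by simp⟩

theorem sub (hω : IsAdditiveSubcategory ω) {f g : M ⟶ N} (hf : FactorsThrough ω f)
    (hg : FactorsThrough ω g) : FactorsThrough ω (f - g) := by
  rw [sub_eq_add_neg]
  exact hf.add hω hg.neg

end FactorsThrough

theorem omegaMonic_isStableUnderRetracts (ω : ObjectProperty A) :
    (omegaMonic ω).IsStableUnderRetracts where
  of_retract {_ _ _ _ f g} h hg W hW x := by
    obtain ⟨y, hy⟩ := hg W hW (h.r.left ≫ x)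
    have hy : g ≫ y = h.r.left ≫ x := hy
    refine ⟨h.i.right ≫ y, ?_⟩
    change f ≫ h.i.right ≫ y = x
    rw [← h.i_w_assoc, hy]
    simp

variable [Preadditive A]

theorem omegaMonic_of_isZero_source (ω : ObjectProperty A) {M N : A} (hM : IsZero M) (f : M ⟶ N) :
    omegaMonic ω f :=
  fun _ _ _ => ⟨0, hM.eq_of_src _ _⟩

/-- The morphisms which induce bijections on morphisms modulo `ω` to objects of `Y`. -/
def localEquivalences (Y ω : ObjectProperty A) : MorphismProperty A :=
  fun M N f => ∀ Z : A, Y Z → (∀ g : M ⟶ Z, ∃ h : N ⟶ Z, FactorsThrough ω (f ≫ h - g)) ∧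
    ∀ h : N ⟶ Z, FactorsThrough ω (f ≫ h) → FactorsThrough ω h

theorem localEquivalences_isStableUnderRetracts (Y : ObjectProperty A) (ω : ObjectProperty A) :
    (localEquivalences Y ω).IsStableUnderRetracts where
  of_retract {_ _ _ _ f g} h hg Z hZ := by
    refine ⟨fun k => ?_, fun l hl => ?_⟩
    · obtain ⟨l, hl⟩ := (hg Z hZ).1 (h.r.left ≫ k)
      refine ⟨h.i.right ≫ l, ?_⟩
      have := hl.comp_left h.i.left
      simpa [h.i_w_assoc] using this
    · have h₁ : FactorsThrough ω (h.r.right ≫ l) := (hg Z hZ).2 _ (by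
        have := hl.comp_left h.r.left
        rwa [h.r_w_assoc] at this)
      have := h₁.comp_left h.i.right
      simpa using this

theorem ExactStructure.IsCotorsionPair.ext1Vanishes [HasZeroObject A] {E : ExactStructure A}
    {X Y : ObjectProperty A} (h : E.IsCotorsionPair X Y) ⦃C K : A⦄ (hC : X C) (hK : Y K) :
    E.Ext1Vanishes C K :=
  (h.left_iff C).1 hC K hK

variable [HasZeroObject A] [HasBinaryBiproducts A]

theorem IsAdditiveSubcategory.inf {P Q : ObjectProperty A} (hP : IsAdditiveSubcategory P)
    (hQ : IsAdditiveSubcategory Q) : IsAdditiveSubcategory (P ⊓ Q) where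
  zero_mem := ⟨hP.zero_mem, hQ.zero_mem⟩
  biprod_mem M N h h' := ⟨hP.biprod_mem M N h.1 h'.1, hQ.biprod_mem M N h.2 h'.2⟩
  iso_mem e h := ⟨hP.iso_mem e h.1, hQ.iso_mem e h.2⟩
  summand_mem M N h := ⟨hP.summand_mem M N h.1, hQ.summand_mem M N h.2⟩

/-- This is two out of three for bijections between the groups Hom(-, Z)/ω. -/
theorem localEquivalences_hasTwoOutOfThree (Y : ObjectProperty A) {ω : ObjectProperty A}
    (hω : IsAdditiveSubcategory ω) : (localEquivalences Y ω).HasTwoOutOfThreeProperty where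
  comp_mem f g hf hg Z hZ := by
    refine ⟨fun k => ?_, fun h hh => ?_⟩
    · obtain ⟨h, hh⟩ := (hf Z hZ).1 k
      obtain ⟨l, hl⟩ := (hg Z hZ).1 h
      refine ⟨l, ?_⟩
      have := (hl.comp_left f).add hω hh
      simpa using this
    · exact (hg Z hZ).2 h ((hf Z hZ).2 _ (by simpa using hh))
  of_postcomp f g hg hfg Z hZ := by
    refine ⟨fun k => ?_, fun h hh => ?_⟩
    · obtain ⟨h, hh⟩ := (hfg Z hZ).1 k
      exact ⟨g ≫ h, by simpa using hh⟩
    · obtain ⟨l, hl⟩ := (hg Z hZ).1 h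
      have h₁ : FactorsThrough ω l := (hfg Z hZ).2 l (by
        have := (hl.comp_left f).add hω hh
        simpa using this)
      have := (h₁.comp_left g).sub hω hl
      simpa using this
  of_precomp f g hf hfg Z hZ := by
    refine ⟨fun k => ?_, fun h hh => ?_⟩
    · obtain ⟨l, hl⟩ := (hfg Z hZ).1 (f ≫ k)
      exact ⟨l, (hf Z hZ).2 _ (by simpa using hl)⟩
    · exact (hfg Z hZ).2 h (by simpa using hh.comp_left f)

namespace ExactStructure

variable {E : ExactStructure A} (hE : E.IsWeaklyIdempotentComplete) {X Y : ObjectProperty A}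

/-! ### Trivial cofibrations, trivial fibrations and trivial objects. -/

section Weq

theorem omegaWeq_of_inflation (hX : IsAdditiveSubcategory X) (hY : IsAdditiveSubcategory Y)
    {M N : A} {f : M ⟶ N} (hf : E.inflationWithCokernelIn X f) : omegaWeq E X Y f := by
  obtain ⟨C, c, h, hC⟩ := hf
  refine ⟨0, 0, ⟨hX.zero_mem, hY.zero_mem⟩, C, biprod.fst ≫ c,
    h.of_iso (Iso.refl _) ⟨biprod.inl, biprod.fst, by simp, ?_⟩ (Iso.refl _) ?_ (by simp), hC⟩
  · apply biprod.hom_ext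
    · simp
    · exact (isZero_zero A).eq_of_tgt _ _
  · ext
    simp

include hE

/-- With t a retraction onto the kernel, (f, t) is an isomorphism, so its cokernel is 0. -/
theorem omegaWeq_of_splitEpi (hX : IsAdditiveSubcategory X) {M N : A} {f : M ⟶ N}
    (hf : splitEpiWithKernelIn (X ⊓ Y) f) : omegaWeq E X Y f := by
  obtain ⟨⟨⟨s, hs⟩⟩, K, k, w, ⟨hk⟩, hK⟩ := hf
  have : Mono k := mono_of_isLimit_fork hk
  have h : E.IsConflation k f := isConflation_of_section hE w (fun T x hx =>
    ⟨hk.lift (KernelFork.ofι x hx), hk.fac (KernelFork.ofι x hx) WalkingParallelPair.zero⟩) s hs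
  obtain ⟨r, hr₁, hr₂⟩ := h.exists_retraction s hs
  have hsr : s ≫ r = 0 := by
    rw [← cancel_mono k, Category.assoc, hr₂, Preadditive.comp_sub, reassoc_of% hs]
    simp
  refine ⟨K, r, hK, 0, 0, (isConflation_id_zero hE M).of_iso (Iso.refl _)
    ⟨biprod.lift f r, biprod.desc s k, ?_, ?_⟩ (Iso.refl _) (by simp) (by simp), hX.zero_mem⟩
  · rw [biprod.lift_desc, hr₂]
    simp
  · ext <;> simp [hs, hsr, w, hr₁]

/-- Since t = f ≫ s, an automorphism of N ⊕ W turns (f, t) into (f, 0), and the zero component can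
be dropped by `of_comp_inl`. -/
theorem inflationWithCokernelIn_of_omegaMonic (hX : IsAdditiveSubcategory X) {M N : A} {f : M ⟶ N}
    (hf : omegaMonic (X ⊓ Y) f) (hf' : omegaWeq E X Y f) : E.inflationWithCokernelIn X f := by
  obtain ⟨W, t, hW, C, c, h, hC⟩ := hf'
  obtain ⟨s, hs⟩ := hf W hW t
  have hs : f ≫ s = t := hs
  have h' : E.IsConflation (f ≫ (biprod.inl : N ⟶ N ⊞ W))
      (biprod.lift biprod.fst (biprod.snd + biprod.fst ≫ s) ≫ c) := by
    refine h.of_iso (Iso.refl _) ⟨biprod.lift biprod.fst (biprod.snd - biprod.fst ≫ s),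
      biprod.lift biprod.fst (biprod.snd + biprod.fst ≫ s), ?_, ?_⟩ (Iso.refl _) ?_ ?_
    · ext <;> simp
    · ext <;> simp
    · ext <;> simp [hs]
    · simp only [Iso.refl_hom, Category.comp_id]
      rw [← Category.assoc]
      convert (Category.id_comp c).symm using 2
      ext <;> simp
  obtain ⟨Q, q, l, r, hq, hlr⟩ := h'.of_comp_inl hE
  exact ⟨Q, q, hq, retract_mem hE hX l r hlr hC⟩

theorem omegaWeq_zero_iff (hX : IsAdditiveSubcategory X) (hY : IsAdditiveSubcategory Y) (M : A) :
    omegaWeq E X Y (0 : (0 : A) ⟶ M) ↔ X M := by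
  refine ⟨?_, fun hM => omegaWeq_of_inflation hX hY ⟨M, 𝟙 M, isConflation_zero_id hE M, hM⟩⟩
  rintro ⟨W, t, hW, C, c, h, hC⟩
  obtain ⟨y, hy⟩ := h.exists_desc (𝟙 _) ((isZero_zero A).eq_of_src _ _)
  exact retract_mem hE hX (biprod.inl ≫ c) (y ≫ biprod.fst) (by simp [reassoc_of% hy]) hC

theorem deflationWithKernelIn_zero_iff (hY : IsAdditiveSubcategory Y) (M : A) :
    E.deflationWithKernelIn Y (0 : M ⟶ (0 : A)) ↔ Y M := by
  refine ⟨?_, fun hM => ⟨M, 𝟙 M, isConflation_id_zero hE M, hM⟩⟩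
  rintro ⟨K, k, h, hK⟩
  obtain ⟨y, hy⟩ := h.exists_lift (𝟙 M) (by simp)
  exact retract_mem hE hY y k hy hK

end Weq

include hE in
-- A retract f of g satisfies `h.r.left ≫ f = g ≫ h.r.right`, a deflation followed by a split
-- epimorphism. So f is a deflation, and its kernel is a retract of that of g.
theorem deflationWithKernelIn_isStableUnderRetracts (hY : IsAdditiveSubcategory Y) :
    (E.deflationWithKernelIn Y).IsStableUnderRetracts where
  of_retract {M N _ _ f g} h := by
    rintro ⟨K', k', hg, hK'⟩
    have hd : E.IsDeflation (h.r.left ≫ f) := by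
      rw [h.r_w]
      exact hg.isDeflation.comp (hE _ inferInstance)
    obtain ⟨K, k, hk⟩ := hd.of_comp hE
    have := hk.mono
    obtain ⟨a, ha⟩ := hg.exists_lift (k ≫ h.i.left) (by
      rw [Category.assoc, h.i_w, reassoc_of% hk.zero, zero_comp])
    obtain ⟨b, hb⟩ := hk.exists_lift (k' ≫ h.r.left) (by
      rw [Category.assoc, h.r_w, reassoc_of% hg.zero, zero_comp])
    refine ⟨K, k, hk, retract_mem hE hY a b ?_ hK'⟩
    rw [← cancel_mono k, Category.assoc, hb, reassoc_of% ha]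
    simp

section Orthogonal

variable (hXY : ∀ ⦃C K : A⦄, X C → Y K → E.Ext1Vanishes C K)
include hE hXY

theorem omegaMonic_of_inflation {M N : A} {f : M ⟶ N} (hf : E.inflationWithCokernelIn X f) :
    omegaMonic (X ⊓ Y) f := by
  obtain ⟨C, c, h, hC⟩ := hf
  exact fun W hW g => (hXY hC hW.2).exists_extension hE h g

theorem omegaMonic_inf_omegaWeq (hX : IsAdditiveSubcategory X) (hY : IsAdditiveSubcategory Y) :
    omegaMonic (X ⊓ Y) ⊓ omegaWeq E X Y = E.inflationWithCokernelIn X := by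
  ext M N f
  exact ⟨fun h => inflationWithCokernelIn_of_omegaMonic hE hX h.1 h.2,
    fun h => ⟨omegaMonic_of_inflation hE hXY h, omegaWeq_of_inflation hX hY h⟩⟩

theorem splitEpiWithKernelIn_of_deflation (hX : IsAdditiveSubcategory X) {M N : A} {f : M ⟶ N}
    (hf : E.deflationWithKernelIn Y f) (hf' : omegaWeq E X Y f) :
    splitEpiWithKernelIn (X ⊓ Y) f := by
  obtain ⟨K, k, hk, hK⟩ := hf
  obtain ⟨W, t, hW, C, c, h, hC⟩ := hf'
  have := hk.mono
  -- Lifting (f, t) against f itself gives b : N ⊕ W → M. On N it is a section of f; on W it lands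
  -- in K and exhibits K as a retract of W.
  obtain ⟨b, hb₁, hb₂⟩ := (hXY hC hK).exists_diagonal hE h hk (𝟙 M) biprod.fst (by simp)
  obtain ⟨w, hw⟩ := id hk
  obtain ⟨r, hr⟩ := hk.exists_lift (biprod.inr ≫ b) (by simp [hb₂])
  have hkt : (k ≫ t) ≫ biprod.inr = k ≫ biprod.lift f t := by
    apply biprod.hom_ext <;> simp [hk.zero]
  refine ⟨⟨⟨biprod.inl ≫ b, by simp [hb₂]⟩⟩, K, k, w, E.kernel_of_conflation _ hw,
    retract_mem hE hX (k ≫ t) r ?_ hW.1, hK⟩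
  rw [← cancel_mono k, Category.assoc, hr, ← Category.assoc, hkt, Category.assoc, hb₁]
  simp

theorem deflationWithKernelIn_inf_omegaWeq (hX : IsAdditiveSubcategory X) :
    E.deflationWithKernelIn Y ⊓ omegaWeq E X Y = splitEpiWithKernelIn (X ⊓ Y) := by
  ext M N f
  refine ⟨fun h => splitEpiWithKernelIn_of_deflation hE hXY hX h.1 h.2,
    fun h => ⟨?_, omegaWeq_of_splitEpi hE hX h⟩⟩
  obtain ⟨⟨⟨s, hs⟩⟩, K, k, w, ⟨hk⟩, hK⟩ := h
  have : Mono k := mono_of_isLimit_fork hk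
  exact ⟨K, k, isConflation_of_section hE w (fun T x hx => ⟨hk.lift (KernelFork.ofι x hx),
    hk.fac (KernelFork.ofι x hx) WalkingParallelPair.zero⟩) s hs, hK.2⟩

end Orthogonal

/-! ### From cotorsion pairs to the model structure. -/

section CotorsionPair

namespace IsCotorsionPair

variable (h : E.IsCotorsionPair X Y)
include h hE

/-- An extension of L by N in Y splits over K, and this partial splitting extends to L by lifting
against K → L. -/
theorem left_extension {K L M : A} {i : K ⟶ L} {d : L ⟶ M} (hc : E.IsConflation i d) (hK : X K)
    (hM : X M) : X L := by
  refine (h.left_iff L).2 fun N hN => ext1Vanishes_of_sections fun P k p hp => ?_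
  obtain ⟨s, hs⟩ := (h.ext1Vanishes hK hN).exists_lifting hE hp i
  obtain ⟨b, -, hb⟩ := (h.ext1Vanishes hM hN).exists_diagonal hE hc hp s (𝟙 L) (by simp [hs])
  exact ⟨b, hb⟩

theorem right_extension {K L M : A} {i : K ⟶ L} {d : L ⟶ M} (hc : E.IsConflation i d) (hK : Y K)
    (hM : Y M) : Y L := by
  refine (h.right_iff L).2 fun N hN => ext1Vanishes_of_sections fun P k p hp => ?_
  obtain ⟨s, hs⟩ := (h.ext1Vanishes hN hM).exists_extension hE hp d
  obtain ⟨b, hb, -⟩ := (h.ext1Vanishes hN hK).exists_diagonal hE hp hc (𝟙 L) s (by simp [hs])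
  exact hp.exists_section b hb

theorem deflationWithKernelIn_comp {L M N : A} {f : L ⟶ M} {g : M ⟶ N}
    (hf : E.deflationWithKernelIn Y f) (hg : E.deflationWithKernelIn Y g) :
    E.deflationWithKernelIn Y (f ≫ g) := by
  obtain ⟨K, k, hk, hK⟩ := hf
  obtain ⟨K', k', hk', hK'⟩ := hg
  obtain ⟨Q, q, b, a, sq, ha, -⟩ := hk.exists_pullback k'
  exact ⟨Q, q, hk.comp_of_isPullback hk' sq, h.right_extension hE ha hK hK'⟩

end IsCotorsionPair

namespace IsCompleteCotorsionPair

variable (h : E.IsCompleteCotorsionPair X Y)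
include h hE

/-- Embed C in W in Y with cokernel in X: W is in X as an extension, and f extends to W. -/
theorem factorsThrough {C K : A} (f : C ⟶ K) (hC : X C) (hK : Y K) :
    FactorsThrough (X ⊓ Y) f := by
  obtain ⟨W, L, i, d, hc, hW, hL⟩ := h.exists_right C
  obtain ⟨b, hb⟩ := (h.ext1Vanishes hL hK).exists_extension hE hc f
  exact ⟨W, i, b, ⟨h.left_extension hE hc hC hL, hW⟩, hb.symm⟩

theorem exists_factorization {M N : A} (f : M ⟶ N) :
    ∃ (L : A) (i : M ⟶ L) (p : L ⟶ N), E.inflationWithCokernelIn X i ∧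
      E.deflationWithKernelIn Y p ∧ i ≫ p = f := by
  -- Embedding M in Z makes (f, a) : M → N ⊕ Z an inflation. Pulling its cokernel C back along L →
  -- C, with L in X and kernel in Y, replaces the cokernel by L and changes the middle term only by
  -- a fibration.
  obtain ⟨Z, S, a, s, ha, hZ, -⟩ := h.exists_right M
  obtain ⟨C, c, hc⟩ := ha.exists_lift_biprod f
  obtain ⟨K, L, k, d, hd, hK, hL⟩ := h.exists_left C
  obtain ⟨P, f', d', k', sq, hd', -⟩ := hd.exists_pullback c
  obtain ⟨i, hi, hid⟩ := hc.of_isPullback sq.flip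
  refine ⟨P, i, d' ≫ biprod.fst, ⟨L, f', hi, hL⟩,
    h.deflationWithKernelIn_comp hE ⟨K, k', hd', hK⟩
      ⟨Z, biprod.inr, isConflation_inr_fst hE N Z, hZ⟩, by rw [reassoc_of% hid, biprod.lift_fst]⟩

theorem localEquivalences_of_omegaWeq (hX : IsAdditiveSubcategory X) (hY : IsAdditiveSubcategory Y)
    {M N : A} {f : M ⟶ N} (hf : omegaWeq E X Y f) : localEquivalences Y (X ⊓ Y) f := by
  obtain ⟨W, t, hW, C, c, hc, hC⟩ := hf
  intro Z hZ
  refine ⟨fun g => ?_, ?_⟩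
  · obtain ⟨b, hb⟩ := (h.ext1Vanishes hC hZ).exists_extension hE hc g
    refine ⟨biprod.inl ≫ b, W, -t, biprod.inr ≫ b, hW, ?_⟩
    rw [← hb, biprod.lift_eq]
    simp
  · rintro g ⟨V, a, b, hV, hab⟩
    obtain ⟨a', ha'⟩ := (h.ext1Vanishes hC hV.2).exists_extension hE hc a
    -- The part of g not passing through V descends to C → Z, which factors through ω since C is in
    -- X and Z in Y.
    obtain ⟨y, hy⟩ := hc.exists_desc (biprod.fst ≫ g - a' ≫ b) (by
      rw [Preadditive.comp_sub, biprod.lift_fst_assoc, hab, reassoc_of% ha', sub_self])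
    have h₁ : FactorsThrough (X ⊓ Y) (biprod.inl ≫ (c ≫ y + a' ≫ b)) :=
      (((h.factorsThrough hE y hC hZ).comp_left c).add (hX.inf hY) ⟨V, a', b, hV, rfl⟩).comp_left _
    rw [hy] at h₁
    simpa using h₁

/-- A deflation between objects of `Y` with kernel in `Y` that is invertible modulo `X ⊓ Y` splits,
and its kernel lies in `X`. -/
theorem exists_section_of_localEquivalences (hX : IsAdditiveSubcategory X)
    {K M N : A} {k : K ⟶ M} {p : M ⟶ N} (hp : E.IsConflation k p)
    (hK : Y K) (hM : Y M) (hN : Y N) (hl : localEquivalences Y (X ⊓ Y) p) :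
    X K ∧ ∃ s : N ⟶ M, s ≫ p = 𝟙 N := by
  obtain ⟨s₀, hs₀⟩ := (hl M hM).1 (𝟙 M)
  obtain ⟨W, a, b, hW, hab⟩ := (hl N hN).2 (s₀ ≫ p - 𝟙 N) (by
    simpa using hs₀.comp_right p)
  -- The section s₀ is right only up to a morphism through W; lifting W → N along p corrects it.
  obtain ⟨b', hb'⟩ := (h.ext1Vanishes hW.1 hK).exists_lifting hE hp b
  have hs : (s₀ - a ≫ b') ≫ p = 𝟙 N := by
    rw [Preadditive.sub_comp, Category.assoc, hb', ← hab, sub_sub_cancel]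
  obtain ⟨r, hr, -⟩ := hp.exists_retraction _ hs
  obtain ⟨V, c, d, hV, hcd⟩ := hs₀
  -- On K the morphism `p ≫ s₀ - 𝟙 M` is -k, and it factors through V; hence K is a retract of V.
  refine ⟨retract_mem hE hX (k ≫ c) (-(d ≫ r)) ?_ hV.1, _, hs⟩
  rw [Preadditive.comp_neg, Category.assoc, ← Category.assoc c, ← hcd, Preadditive.sub_comp,
    Preadditive.comp_sub, Category.assoc, reassoc_of% hp.zero]
  simp [hr]

theorem omegaWeq_of_localEquivalences
    (hker : ∀ {K L M : A} (i : K ⟶ L) (d : L ⟶ M), E.IsConflation i d → X L → X M → X K)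
    (hX : IsAdditiveSubcategory X) (hY : IsAdditiveSubcategory Y)
    {M N : A} {f : M ⟶ N} (hf : localEquivalences Y (X ⊓ Y) f) : omegaWeq E X Y f := by
  obtain ⟨Z, S, r, σ, hr, hZ, hS⟩ := h.exists_right N
  obtain ⟨L, i, p, ⟨C, c, hi, hC⟩, ⟨K, k, hp, hK⟩, hip⟩ := h.exists_factorization hE (f ≫ r)
  have hL : Y L := h.right_extension hE hp hK hZ
  have := localEquivalences_hasTwoOutOfThree Y (hX.inf hY)
  have hloc : ∀ {P Q C : A} {j : P ⟶ Q} {c : Q ⟶ C}, E.IsConflation j c → X C →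
      localEquivalences Y (X ⊓ Y) j := fun hj hC =>
    h.localEquivalences_of_omegaWeq hE hX hY (omegaWeq_of_inflation hX hY ⟨_, _, hj, hC⟩)
  have hfr : localEquivalences Y (X ⊓ Y) (i ≫ p) := hip ▸ MorphismProperty.comp_mem _ f r hf
    (hloc hr hS)
  obtain ⟨hK', s, hs⟩ := h.exists_section_of_localEquivalences hE hX hp hK hL hZ
    (MorphismProperty.of_precomp _ i p (hloc hi hC) hfr)
  have := hp.mono
  have := hr.mono
  obtain ⟨u, hu₁, hu₂⟩ := hp.exists_retraction s hs
  have hsu : s ≫ u = 0 := by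
    rw [← cancel_mono k, Category.assoc, hu₂, Preadditive.comp_sub, reassoc_of% hs]
    simp
  -- The inflation i, read through the splitting L ≅ Z ⊕ K.
  have hc : E.IsConflation (biprod.lift (f ≫ r) (i ≫ u)) (biprod.desc s k ≫ c) := by
    have e : biprod.lift p u ≫ biprod.desc s k = 𝟙 L := by
      rw [biprod.lift_desc, hu₂]
      simp
    refine hi.of_iso (Iso.refl _) ⟨biprod.lift p u, biprod.desc s k, e, ?_⟩ (Iso.refl _) ?_ ?_
    · ext <;> simp [hs, hsu, hp.zero, hu₁]
    · ext <;> simp [hip]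
    · simp [reassoc_of% e]
  obtain ⟨e, he⟩ := hc.exists_desc (biprod.fst ≫ σ) (by simp [hr.zero])
  have hd : E.IsDeflation e := by
    apply IsDeflation.of_comp hE (h := biprod.desc s k ≫ c)
    rw [he]
    exact (isConflation_inr_fst hE Z K).isDeflation.comp hr.isDeflation
  obtain ⟨D, j, hj⟩ := hd
  have := hj.mono
  obtain ⟨q, hq⟩ := hj.exists_lift (biprod.map r (𝟙 K) ≫ biprod.desc s k ≫ c) (by
    rw [Category.assoc, he, biprod.map_fst_assoc, hr.zero, comp_zero])
  have key : ∀ {T : A} (x : T ⟶ Z ⊞ K) (y : T ⟶ D), x ≫ biprod.desc s k ≫ c = y ≫ j →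
      ∃ n : T ⟶ N, n ≫ r = x ≫ biprod.fst := fun x y hxy =>
    hr.exists_lift (x ≫ biprod.fst) (by
      rw [Category.assoc, ← he, ← Category.assoc, hxy, Category.assoc, hj.zero, comp_zero])
  -- N ⊕ K is the kernel of Z ⊕ K → S, hence the preimage of D = Ker(C → S). So M → N ⊕ K is an
  -- inflation with cokernel D, and D is in X by heredity.
  have sq : IsPullback (biprod.map r (𝟙 K)) q (biprod.desc s k ≫ c) j := by
    refine ⟨⟨hq.symm⟩, ⟨PullbackCone.IsLimit.mk _
      (fun t => biprod.lift (key t.fst t.snd t.condition).choose (t.fst ≫ biprod.snd))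
      (fun t => ?_) (fun t => ?_) (fun t m h₁ _ => ?_)⟩⟩
    · have := (key t.fst t.snd t.condition).choose_spec
      ext <;> simp [this]
    · have := (key t.fst t.snd t.condition).choose_spec
      rw [← cancel_mono j, Category.assoc, hq, ← t.condition, ← Category.assoc]
      congr 1
      ext <;> simp [this]
    · have := (key t.fst t.snd t.condition).choose_spec
      apply biprod.hom_ext
      · rw [← cancel_mono r, biprod.lift_fst, this, ← h₁]
        simp
      · rw [biprod.lift_snd, ← h₁]
        simp
  obtain ⟨f', hf', e'⟩ := hc.of_isPullback sq
  have : f' = biprod.lift f (i ≫ u) := by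
    apply biprod.hom_ext
    · rw [← cancel_mono r]
      simpa using e' =≫ biprod.fst
    · simpa using e' =≫ biprod.snd
  exact ⟨K, i ≫ u, ⟨hK', hK⟩, D, q, this ▸ hf', hker j e hj hC hS⟩

end IsCompleteCotorsionPair

namespace IsHereditaryCompleteCotorsionPair

variable (h : E.IsHereditaryCompleteCotorsionPair X Y)
include h hE

theorem omegaWeq_eq_localEquivalences (hX : IsAdditiveSubcategory X)
    (hY : IsAdditiveSubcategory Y) : omegaWeq E X Y = localEquivalences Y (X ⊓ Y) := by
  ext M N f
  exact ⟨h.localEquivalences_of_omegaWeq hE hX hY,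
    h.omegaWeq_of_localEquivalences hE (fun i d hc => h.kernel_mem i d hc) hX hY⟩

theorem isModelStructure (hX : IsAdditiveSubcategory X) (hY : IsAdditiveSubcategory Y)
    (hω : IsCovariantlyFinite (X ⊓ Y)) :
    IsModelStructure (omegaMonic (X ⊓ Y)) (E.deflationWithKernelIn Y) (omegaWeq E X Y) where
  two_out_of_three := by
    rw [h.omegaWeq_eq_localEquivalences hE hX hY]
    exact localEquivalences_hasTwoOutOfThree Y (hX.inf hY)
  cof_retract := omegaMonic_isStableUnderRetracts _
  fib_retract := deflationWithKernelIn_isStableUnderRetracts hE hY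
  weq_retract := by
    rw [h.omegaWeq_eq_localEquivalences hE hX hY]
    exact localEquivalences_isStableUnderRetracts Y _
  lifting_left i p hi hi' hp := by
    obtain ⟨C, c, hc, hC⟩ := inflationWithCokernelIn_of_omegaMonic hE hX hi hi'
    obtain ⟨K, k, hk, hK⟩ := hp
    refine ⟨fun {f g} sq => ?_⟩
    obtain ⟨b, hb₁, hb₂⟩ := (h.ext1Vanishes hC hK).exists_diagonal hE hc hk f g sq.w
    exact ⟨⟨⟨b, hb₁, hb₂⟩⟩⟩
  lifting_right i p hi hp hp' := by
    obtain ⟨⟨⟨s, hs⟩⟩, K, k, w, ⟨hk⟩, hK⟩ :=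
      splitEpiWithKernelIn_of_deflation hE h.ext1Vanishes hX hp hp'
    refine ⟨fun {f g} sq => ?_⟩
    obtain ⟨y, hy⟩ : ∃ y, y ≫ k = f - i ≫ g ≫ s :=
      ⟨hk.lift (KernelFork.ofι (f - i ≫ g ≫ s) (by simp [sq.w, hs])),
        hk.fac (KernelFork.ofι (f - i ≫ g ≫ s) _) WalkingParallelPair.zero⟩
    obtain ⟨z, hz⟩ := hi K hK y
    have hz : i ≫ z = y := hz
    exact ⟨⟨⟨g ≫ s + z ≫ k, by simp [reassoc_of% hz, hy], by simp [hs, w]⟩⟩⟩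
  factor_left f := by
    obtain ⟨L, i, p, hi, hp, e⟩ := h.exists_factorization hE f
    exact ⟨L, i, p, omegaMonic_of_inflation hE h.ext1Vanishes hi, omegaWeq_of_inflation hX hY hi,
      hp, e⟩
  factor_right {M N} f := by
    obtain ⟨W, t, hW, ht⟩ := hω M
    have hp : (E.deflationWithKernelIn Y ⊓ omegaWeq E X Y) (biprod.fst : N ⊞ W ⟶ N) := by
      rw [deflationWithKernelIn_inf_omegaWeq hE h.ext1Vanishes hX]
      obtain ⟨w, hw⟩ := isConflation_inr_fst hE N W
      exact ⟨⟨⟨biprod.inl, by simp⟩⟩, W, biprod.inr, w, E.kernel_of_conflation _ hw, hW⟩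
    refine ⟨N ⊞ W, biprod.lift f t, biprod.fst, fun W' hW' g => ?_, hp.1, hp.2, by simp⟩
    obtain ⟨b, hb⟩ := ht W' g hW'
    exact ⟨biprod.snd ≫ b, by simp [hb]⟩

end IsHereditaryCompleteCotorsionPair

end CotorsionPair

/-! ### From the model structure to the cotorsion pair. -/

section OfModelStructure

variable (hX : IsAdditiveSubcategory X) (hY : IsAdditiveSubcategory Y)
  (hM : IsModelStructure (omegaMonic (X ⊓ Y)) (E.deflationWithKernelIn Y) (omegaWeq E X Y))
include hE hX hY hM

theorem ext1Vanishes_of_isModelStructure ⦃C K : A⦄ (hC : X C) (hK : Y K) :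
    E.Ext1Vanishes C K := by
  refine ext1Vanishes_of_sections fun P i d hd => ?_
  have := hM.lifting_left (0 : (0 : A) ⟶ C) d (omegaMonic_of_isZero_source _ (isZero_zero A) _)
    ((omegaWeq_zero_iff hE hX hY C).2 hC) ⟨K, i, hd, hK⟩
  have sq : CommSq (0 : (0 : A) ⟶ P) (0 : (0 : A) ⟶ C) d (𝟙 C) := ⟨by simp⟩
  exact ⟨sq.lift, sq.fac_right⟩

theorem isCompleteCotorsionPair_of_isModelStructure : E.IsCompleteCotorsionPair X Y := by
  have hXY := ext1Vanishes_of_isModelStructure hE hX hY hM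
  have left (M : A) : ∃ (K L : A) (i : K ⟶ L) (d : L ⟶ M), E.IsConflation i d ∧ Y K ∧ X L := by
    obtain ⟨L, i, p, -, hi, ⟨K, k, hk, hK⟩, -⟩ := hM.factor_left (0 : (0 : A) ⟶ M)
    obtain rfl : i = 0 := (isZero_zero A).eq_of_src _ _
    exact ⟨K, L, k, p, hk, hK, (omegaWeq_zero_iff hE hX hY L).1 hi⟩
  have right (M : A) : ∃ (K L : A) (i : M ⟶ K) (d : K ⟶ L), E.IsConflation i d ∧ Y K ∧ X L := by
    obtain ⟨L, i, p, hi, hi', hp, -⟩ := hM.factor_left (0 : M ⟶ (0 : A))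
    obtain rfl : p = 0 := (isZero_zero A).eq_of_tgt _ _
    obtain ⟨C, c, hc, hC⟩ := inflationWithCokernelIn_of_omegaMonic hE hX hi hi'
    exact ⟨L, C, i, c, hc, (deflationWithKernelIn_zero_iff hE hY L).1 hp, hC⟩
  refine ⟨⟨fun M => ⟨fun hM N hN => hXY hM hN, fun hM => ?_⟩,
    fun N => ⟨fun hN M hM => hXY hM hN, fun hN => ?_⟩⟩, left, right⟩
  -- Orthogonality splits the approximation sequence of M, making M a retract of L.
  · obtain ⟨K, L, i, d, hd, hK, hL⟩ := left M
    obtain ⟨s, hs⟩ := (hM K hK).exists_section hE hd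
    exact retract_mem hE hX s d hs hL
  · obtain ⟨K, L, i, d, hd, hK, hL⟩ := right N
    obtain ⟨r, hr⟩ := (hN L hL).exists_extension hE hd (𝟙 N)
    exact retract_mem hE hY i r hr hK

/-- Factor M → 0 as a cofibration M → L and a trivial fibration: L is trivial and fibrant, hence in
ω, and ω-monic means that M → L is a left approximation. -/
theorem isCovariantlyFinite_of_isModelStructure : IsCovariantlyFinite (X ⊓ Y) := by
  intro M
  have := hM.two_out_of_three
  obtain ⟨L, j, q, hj, hq, hq', -⟩ := hM.factor_right (0 : M ⟶ (0 : A))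
  obtain rfl : q = 0 := (isZero_zero A).eq_of_tgt _ _
  have h₀ : omegaWeq E X Y ((0 : (0 : A) ⟶ L) ≫ (0 : L ⟶ (0 : A))) := by
    rw [comp_zero, omegaWeq_zero_iff hE hX hY]
    exact hX.zero_mem
  refine ⟨L, j, ⟨(omegaWeq_zero_iff hE hX hY L).1 (MorphismProperty.of_postcomp _ _ _ hq' h₀),
    (deflationWithKernelIn_zero_iff hE hY L).1 hq⟩, fun W g hW => ?_⟩
  exact hj W hW g

theorem kernel_mem_of_isModelStructure {K L M : A} (i : K ⟶ L) (d : L ⟶ M)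
    (hd : E.IsConflation i d) (hL : X L) (hM' : X M) : X K := by
  have := hM.two_out_of_three
  rw [← omegaWeq_zero_iff hE hX hY] at hL ⊢
  refine MorphismProperty.of_postcomp _ _ i (omegaWeq_of_inflation hX hY ⟨M, d, hd, hM'⟩) ?_
  rwa [zero_comp]

end OfModelStructure

/-- In a complete cotorsion pair `(X, Y)`, if `X` is closed under kernels of deflations between
its objects, then `Y` is closed under cokernels of inflations between its objects. -/
theorem IsCompleteCotorsionPair.isHereditary (h : E.IsCompleteCotorsionPair X Y)
    (hE : E.IsWeaklyIdempotentComplete)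
    (hker : ∀ {K L M : A} (i : K ⟶ L) (d : L ⟶ M), E.IsConflation i d → X L → X M → X K) :
    E.IsHereditaryCompleteCotorsionPair X Y where
  toIsCompleteCotorsionPair := h
  kernel_mem := hker
  cokernel_mem {K L M} i d hd hK hL := by
    refine (h.right_iff M).2 fun C hC => ext1Vanishes_of_sections fun P j p hp => ?_
    -- Cover P by Q in X. The kernel Q' of Q → C is in X, so Q' → M lifts to L and then extends to Q
    -- → L. The composite Q → L → M kills K' and descends to a retraction P → M.
    obtain ⟨K', Q, k, π, hπ, -, hQ⟩ := h.exists_left P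
    obtain ⟨Q', l, b, k', sq, hb, hk'⟩ := hπ.exists_pullback j
    have hl := hπ.comp_of_isPullback hp sq
    obtain ⟨x, hx⟩ := (h.ext1Vanishes (hker l _ hl hQ hC) hK).exists_lifting hE hd b
    obtain ⟨y, hy⟩ := (h.ext1Vanishes hC hL).exists_extension hE hl x
    obtain ⟨ρ, hρ⟩ := hπ.exists_desc (y ≫ d) (by
      rw [← hk', Category.assoc, reassoc_of% hy, hx, hb.zero])
    refine hp.exists_section ρ ?_
    have := hb.epi
    rw [← cancel_epi b, ← reassoc_of% sq.w, hρ, reassoc_of% hy, hx, Category.comp_id]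

theorem isHereditaryCompleteCotorsionPair_of_isModelStructure
    (hE : E.IsWeaklyIdempotentComplete) (hX : IsAdditiveSubcategory X)
    (hY : IsAdditiveSubcategory Y)
    (hM : IsModelStructure (omegaMonic (X ⊓ Y)) (E.deflationWithKernelIn Y) (omegaWeq E X Y)) :
    E.IsHereditaryCompleteCotorsionPair X Y :=
  (isCompleteCotorsionPair_of_isModelStructure hE hX hY hM).isHereditary hE
    (kernel_mem_of_isModelStructure hE hX hY hM)

end ExactStructure

end ExactCategories

/-! ### The homotopy category. -/

section ExactCategories

variable {A : Type u} [Category.{v} A] [Preadditive A] [HasZeroObject A] [HasBinaryBiproducts A]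

theorem quotient_functor_map_eq_iff {Y ω : ObjectProperty A} (hω : IsAdditiveSubcategory ω)
    {M N : Y.FullSubcategory} (f g : M ⟶ N) :
    (CategoryTheory.Quotient.functor (factorsThroughRel Y ω)).map f =
      (CategoryTheory.Quotient.functor (factorsThroughRel Y ω)).map g ↔
    FactorsThrough ω (f.hom - g.hom) :=
  have := factorsThroughRel_congruence Y hω
  CategoryTheory.Quotient.functor_map_eq_iff _ f g

/-- Between objects of `Y`, the local equivalences are invertible in `Y / ω`. -/
theorem isIso_quotient_functor_map {Y ω : ObjectProperty A} (hω : IsAdditiveSubcategory ω)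
    {M N : Y.FullSubcategory} (f : M ⟶ N) (hf : localEquivalences Y ω f.hom) :
    IsIso ((CategoryTheory.Quotient.functor (factorsThroughRel Y ω)).map f) := by
  obtain ⟨s, hs⟩ := (hf M.obj M.property).1 (𝟙 _)
  have hs' := (hf N.obj N.property).2 (s ≫ f.hom - 𝟙 _) (by simpa using hs.comp_right f.hom)
  refine ⟨(CategoryTheory.Quotient.functor _).map (ObjectProperty.homMk s), ?_, ?_⟩
  · rw [← CategoryTheory.Functor.map_comp, ← CategoryTheory.Functor.map_id,
      quotient_functor_map_eq_iff hω]
    exact hs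
  · rw [← CategoryTheory.Functor.map_comp, ← CategoryTheory.Functor.map_id,
      quotient_functor_map_eq_iff hω]
    exact hs'

namespace ExactStructure

variable {E : ExactStructure A} (hE : E.IsWeaklyIdempotentComplete) {X Y : ObjectProperty A}

include hE in
/-- A functor inverting the weak equivalences identifies morphisms that agree modulo `X ⊓ Y`. -/
theorem map_eq_of_factorsThrough (hX : IsAdditiveSubcategory X) {D : Type*} [Category* D]
    (F : A ⥤ D) (hF : (omegaWeq E X Y).IsInvertedBy F) {M N : A} {f g : M ⟶ N}
    (h : FactorsThrough (X ⊓ Y) (f - g)) : F.map f = F.map g := by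
  obtain ⟨W, a, b, hW, hab⟩ := h
  have hp : omegaWeq E X Y (biprod.fst : M ⊞ W ⟶ M) := by
    obtain ⟨w, hw⟩ := isConflation_inr_fst hE M W
    exact omegaWeq_of_splitEpi hE hX
      ⟨⟨⟨biprod.inl, by simp⟩⟩, W, biprod.inr, w, E.kernel_of_conflation _ hw, hW⟩
  have := hF _ hp
  -- Both (1, a) and (1, 0) are sections of the projection M ⊕ W → M, which F inverts.
  have key : F.map (biprod.lift (𝟙 M) a) = F.map biprod.inl := by
    rw [← cancel_mono (F.map (biprod.fst : M ⊞ W ⟶ M)), ← F.map_comp, ← F.map_comp]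
    simp
  have hf : f = biprod.lift (𝟙 M) a ≫ biprod.desc g b := by
    rw [biprod.lift_desc, Category.id_comp, ← hab, add_sub_cancel]
  rw [hf, F.map_comp, key, ← F.map_comp, biprod.inl_desc]

namespace IsHereditaryCompleteCotorsionPair

open CategoryTheory.Functor in
theorem exists_equivalence_localization (h : E.IsHereditaryCompleteCotorsionPair X Y)
    (hE : E.IsWeaklyIdempotentComplete) (hX : IsAdditiveSubcategory X)
    (hY : IsAdditiveSubcategory Y) :
    ∃ e : AdditiveQuotient Y (X ⊓ Y) ≌ (omegaWeq E X Y).Localization,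
      Nonempty (CategoryTheory.Quotient.functor (factorsThroughRel Y (X ⊓ Y)) ⋙ e.functor ≅
        Y.ι ⋙ (omegaWeq E X Y).Q) := by
  have hω := hX.inf hY
  have := localEquivalences_hasTwoOutOfThree Y hω
  let q := CategoryTheory.Quotient.functor (factorsThroughRel Y (X ⊓ Y))
  choose Z S r σ hr hZ hS using h.exists_right
  have hweq (M : A) : omegaWeq E X Y (r M) :=
    omegaWeq_of_inflation hX hY ⟨S M, σ M, hr M, hS M⟩
  have hloc (M : A) : localEquivalences Y (X ⊓ Y) (r M) :=
    h.localEquivalences_of_omegaWeq hE hX hY (hweq M)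
  have hext {M N : A} (f : M ⟶ N) : ∃ g : Z M ⟶ Z N, r M ≫ g = f ≫ r N :=
    (h.ext1Vanishes (hS M) (hZ N)).exists_extension hE (hr M) _
  choose φ hφ using @hext
  have huniq {M N : A} {f g : Z M ⟶ Z N} (hfg : r M ≫ f = r M ≫ g) :
      q.map (X := ⟨Z M, hZ M⟩) (Y := ⟨Z N, hZ N⟩) (ObjectProperty.homMk f) =
        q.map (ObjectProperty.homMk g) := by
    rw [quotient_functor_map_eq_iff hω]
    refine (hloc M _ (hZ N)).2 _ ⟨0, 0, 0, hω.zero_mem, ?_⟩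
    simp [hfg]
  -- Fibrant replacement: the chosen extensions φ need not respect composition, but they are unique
  -- modulo ω because r is a local equivalence.
  let R : A ⥤ AdditiveQuotient Y (X ⊓ Y) :=
    { obj M := q.obj ⟨Z M, hZ M⟩
      map f := q.map (ObjectProperty.homMk (φ f))
      map_id M := (huniq (g := 𝟙 _) (by simp [hφ])).trans (q.map_id _)
      map_comp f g := (huniq (g := φ f ≫ φ g) (by
        rw [hφ, reassoc_of% hφ, hφ, Category.assoc])).trans
        (q.map_comp (X := ⟨Z _, hZ _⟩) (Y := ⟨Z _, hZ _⟩) (Z := ⟨Z _, hZ _⟩)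
          (ObjectProperty.homMk (φ f)) (ObjectProperty.homMk (φ g))) }
  have hR : (omegaWeq E X Y).IsInvertedBy R := fun M N f hf =>
    isIso_quotient_functor_map hω _ (MorphismProperty.of_precomp _ (r M) (φ f) (hloc M) (by
      rw [hφ]
      exact MorphismProperty.comp_mem _ _ _ (h.localEquivalences_of_omegaWeq hE hX hY hf)
        (hloc N)))
  let Q := (omegaWeq E X Y).Q
  have hQ : (omegaWeq E X Y).IsInvertedBy Q := Localization.inverts _ _
  have hsound : ∀ (M N : Y.FullSubcategory) (f g : M ⟶ N), factorsThroughRel Y (X ⊓ Y) f g →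
      (Y.ι ⋙ Q).map f = (Y.ι ⋙ Q).map g :=
    fun _ _ _ _ hfg => map_eq_of_factorsThrough hE hX Q hQ hfg
  let F : AdditiveQuotient Y (X ⊓ Y) ⥤ (omegaWeq E X Y).Localization :=
    CategoryTheory.Quotient.lift _ (Y.ι ⋙ Q) hsound
  let G : (omegaWeq E X Y).Localization ⥤ AdditiveQuotient Y (X ⊓ Y) := Localization.lift R hR Q
  -- The morphisms r supply both natural isomorphisms: for M in Y they are invertible modulo ω, and
  -- in the localization they are always invertible.
  let unit₀ : q ≅ Y.ι ⋙ R := NatIso.ofComponents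
    (fun M => @asIso _ _ _ _ (q.map (X := M) (Y := ⟨Z M.obj, hZ M.obj⟩)
      (ObjectProperty.homMk (r M.obj))) (isIso_quotient_functor_map hω _ (hloc M.obj)))
    (fun {M N} f => by
      change q.map f ≫ q.map _ = q.map _ ≫ q.map _
      rw [← q.map_comp, ← q.map_comp]
      congr 1
      exact ObjectProperty.hom_ext _ (hφ f.hom).symm)
  let unit : 𝟭 (AdditiveQuotient Y (X ⊓ Y)) ≅ F ⋙ G := CategoryTheory.Quotient.natIsoLift _
    (rightUnitor q ≪≫ unit₀ ≪≫ isoWhiskerLeft Y.ι (Localization.fac R hR Q).symm ≪≫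
      (associator Y.ι Q G).symm ≪≫
      isoWhiskerRight (CategoryTheory.Quotient.lift.isLift _ (Y.ι ⋙ Q) hsound).symm G ≪≫
      associator q F G)
  let counit₀ : R ⋙ F ≅ Q := NatIso.ofComponents
    (fun M => (@asIso _ _ _ _ (Q.map (r M)) (hQ _ (hweq M))).symm)
    (fun {M N} f => by
      have := hQ _ (hweq M)
      have := hQ _ (hweq N)
      change Q.map (φ f) ≫ inv (Q.map (r N)) = inv (Q.map (r M)) ≫ Q.map f
      rw [IsIso.comp_inv_eq, Category.assoc, IsIso.eq_inv_comp, ← Q.map_comp, ← Q.map_comp, hφ])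
  let counit : G ⋙ F ≅ 𝟭 _ :=
    Localization.liftNatIso Q (omegaWeq E X Y) (R ⋙ F) Q (G ⋙ F) (𝟭 _) counit₀
  exact ⟨CategoryTheory.Equivalence.mk F G unit counit,
    ⟨CategoryTheory.Quotient.lift.isLift _ (Y.ι ⋙ Q) hsound⟩⟩

end IsHereditaryCompleteCotorsionPair

end ExactStructure

end ExactCategories

theorem theorem5p6 {A : Type u} [Category.{v} A] [Preadditive A] [HasZeroObject A]
    [HasBinaryBiproducts A] (E : ExactStructure A) (hE : E.IsWeaklyIdempotentComplete)
    (X Y : ObjectProperty A) (hX : IsAdditiveSubcategory X) (hY : IsAdditiveSubcategory Y) :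
    (IsModelStructure (omegaMonic (X ⊓ Y)) (E.deflationWithKernelIn Y) (omegaWeq E X Y) ↔
      E.IsHereditaryCompleteCotorsionPair X Y ∧ IsCovariantlyFinite (X ⊓ Y)) ∧
    (IsModelStructure (omegaMonic (X ⊓ Y)) (E.deflationWithKernelIn Y) (omegaWeq E X Y) →
      omegaMonic (X ⊓ Y) ⊓ omegaWeq E X Y = E.inflationWithCokernelIn X ∧
      E.deflationWithKernelIn Y ⊓ omegaWeq E X Y = splitEpiWithKernelIn (X ⊓ Y) ∧
      cofibrantObjects (omegaMonic (X ⊓ Y)) = ⊤ ∧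
      fibrantObjects (E.deflationWithKernelIn Y) = Y ∧
      trivialObjects (omegaWeq E X Y) = X ∧
      ∃ e : AdditiveQuotient Y (X ⊓ Y) ≌ (omegaWeq E X Y).Localization,
        Nonempty (CategoryTheory.Quotient.functor (factorsThroughRel Y (X ⊓ Y)) ⋙ e.functor ≅
          Y.ι ⋙ (omegaWeq E X Y).Q)) := by
  refine ⟨⟨fun hM =>
    ⟨ExactStructure.isHereditaryCompleteCotorsionPair_of_isModelStructure hE hX hY hM,
      ExactStructure.isCovariantlyFinite_of_isModelStructure hE hX hY hM⟩,
    fun h => h.1.isModelStructure hE hX hY h.2⟩, fun hM => ?_⟩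
  have h := ExactStructure.isHereditaryCompleteCotorsionPair_of_isModelStructure hE hX hY hM
  refine ⟨ExactStructure.omegaMonic_inf_omegaWeq hE h.ext1Vanishes hX hY,
    ExactStructure.deflationWithKernelIn_inf_omegaWeq hE h.ext1Vanishes hX, ?_, ?_, ?_,
    h.exists_equivalence_localization hE hX hY⟩
  · ext M
    exact ⟨fun _ => trivial, fun _ => omegaMonic_of_isZero_source _ (isZero_zero A) _⟩
  · ext M
    exact ExactStructure.deflationWithKernelIn_zero_iff hE hY M
  · ext M
    exact ExactStructure.omegaWeq_zero_iff hE hX hY M
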